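/- Conventions. Manifolds are smooth, finite-dimensional and without boundary (the arrow space of a Lie groupoid is not required to be Hausdorff). For a Poisson structure $\pi$ put $\pi^\sharp(\xi)=\pi(\xi,\cdot)$ and $L_\pi=\{\pi^\sharp(\xi)+\xi\}\subset TM\oplus T^*M$; for a two-form $\omega$ put $L_\omega=\{v+\iota_v\omega\}$. For a map $f:M\to N$, the pullback of $L\subset TN\oplus T^*N$ is $f^*L=\{v+f^*\eta : f_*v+\eta\in L\}$; the gauge transform of $L$ by a two-form $\sigma$ is $L^\sigma=\{v+\xi+\iota_v\sigma : v+\xi\in L\}$. A smooth map $f:(S,\omega)\to(M,\pi)$ from a symplectic manifold is Poisson if for every $x \in S$ one has $\{f_*v+\eta : v+f^*\eta\in L_{\omega,x}\}=L_{\pi,f(x)}$. A two-form $\omega$ on a Lie groupoid $\mathcal G\rightrightarrows M$ with source $\mathbf s$, target $\mathbf t$ and multiplication $\mathbf m:\mathcal G\times_{\mathbf s,\mathbf t}\mathcal G\to\mathcal G$ is multiplicative if $\mathbf m^*\omega=\mathrm{pr}_1^*\omega+\mathrm{pr}_2^*\omega$. A symplectic groupoid is a Lie groupoid with a multiplicative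 symplectic form; it integrates the Poisson manifold $(M,\pi)$ if $$(M,\pi)\xleftarrow{\ \mathbf s\ }(\mathcal G,\omega)\xrightarrow{\ \mathbf t\ }(M,-\pi)$$ is a full dual pair, i.e. $\mathbf s$ and $\mathbf t$ are surjective submersions and Poisson maps, and $\ker\mathbf t_*$ is the $\omega$-orthogonal of $\ker\mathbf s_*$ at every point. Proposition. Let $(X,\pi_X)$ be a Poisson manifold integrated by a symplectic groupoid $(\mathcal G_X,\omega_X)\rightrightarrows X$, let $p:E\to X$ be a surjective submersion, and let $\sigma$ be a closed two-form on $E$ such that $(p^*L_{\pi_X})^\sigma=L_{\pi_X^\sigma}$ for a (globally defined) Poisson structure $\pi_X^\sigma$ on $E$. Let $$\mathcal G_X^E=\{(e',g,e)\in E\times\mathcal G_X\times E : p(e')=\mathbf t(g),\ p(e)=\mathbf s(g)\}$$ be the pullback groupoid over $E$, with structure maps $\mathbf s(e',g,e)=e$, $\mathbf t(e',g,e)=e'$, $(e'',h,e')(e',g,e)=(e'',hg,e)$, $\mathbf 1_e=(e,\mathbf 1_{p(e)},e)$, $(e',g,e)^{-1}=(e,g^{-1},e')$, let $\mathbf p:\mathcal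 G_X^E\to\mathcal G_X$ be the map $(e',g,e)\mapsto g$, and let $$\omega_E=\mathbf p^*\omega_X+\mathbf s^*\sigma-\mathbf t^*\sigma .$$ Then $\mathcal G_X^E$ is an embedded submanifold of $E\times\mathcal G_X\times E$, of dimension $2\dim E$, and with this manifold structure $(\mathcal G_X^E,\omega_E)\rightrightarrows E$ is a symplectic groupoid integrating $(E,\pi_X^\sigma)$. -/

import Mathlib

open scoped Manifold ContDiff

namespace SymplGpd

/-! ### Differential forms of degree two -/

section Forms

variable {n n' : ℕ}
  {M : Type*} [TopologicalSpace M] [ChartedSpace (EuclideanSpace ℝ (Fin n)) M]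
  {N : Type*} [TopologicalSpace N] [ChartedSpace (EuclideanSpace ℝ (Fin n')) N]

variable (n M) in
/-- (Not necessarily smooth) two-forms on an `n`-dimensional manifold `M`. -/
abbrev TwoForm : Type _ :=
  ∀ x : M, (TangentSpace (𝓡 n) x) [⋀^Fin 2]→L[ℝ] ℝ

/-- The coordinate expression of the two-form `Ω` in the preferred chart at `x₀`, i.e. its
pullback along the inverse of this chart. Only its values on the target of the chart matter. -/
noncomputable def TwoForm.inChart (Ω : TwoForm n M) (x₀ : M) :
    EuclideanSpace ℝ (Fin n) → (EuclideanSpace ℝ (Fin n)) [⋀^Fin 2]→L[ℝ] ℝ :=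
  fun y => (Ω ((extChartAt (𝓡 n) x₀).symm y)).compContinuousLinearMap
    (mfderiv (𝓡 n) (𝓡 n) (extChartAt (𝓡 n) x₀).symm y)

/-- A two-form is smooth if its coordinate expressions are. -/
def TwoForm.IsSmooth (Ω : TwoForm n M) : Prop :=
  ∀ x₀ : M, ContDiffOn ℝ ∞ (Ω.inChart x₀) (extChartAt (𝓡 n) x₀).target

/-- A two-form is closed if the exterior derivatives of its coordinate expressions vanish. -/
def TwoForm.IsClosed (Ω : TwoForm n M) : Prop :=
  ∀ x₀ : M, ∀ y ∈ (extChartAt (𝓡 n) x₀).target, extDeriv (Ω.inChart x₀) y = 0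

/-- The pullback `f^* Ω`. -/
noncomputable def TwoForm.pullback (f : M → N) (Ω : TwoForm n' N) : TwoForm n M :=
  fun x => (Ω (f x)).compContinuousLinearMap (mfderiv (𝓡 n) (𝓡 n') f x)

/-- A symplectic form: a smooth closed two-form which is nondegenerate at every point. -/
structure TwoForm.IsSymplectic (Ω : TwoForm n M) : Prop where
  smooth : Ω.IsSmooth
  closed : Ω.IsClosed
  nondegenerate : ∀ (x : M) (v : TangentSpace (𝓡 n) x), (∀ w, Ω x ![v, w] = 0) → v = 0

end Forms

/-! ### Poisson structures -/

section Poisson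

variable {n : ℕ} {M : Type*} [TopologicalSpace M] [ChartedSpace (EuclideanSpace ℝ (Fin n)) M]

variable (n M) in
/-- A field of contravariant two-tensors `π`, given through the maps
`π^♯ : T^*M → TM`, `π(ξ, η) = η (π^♯ ξ)`. Skew-symmetry is part of `IsPoisson`. -/
abbrev TwoTensorField : Type _ :=
  ∀ x : M, (TangentSpace (𝓡 n) x →L[ℝ] ℝ) →L[ℝ] TangentSpace (𝓡 n) x

/-- The bracket `{f, g} = π(df, dg)`. -/
noncomputable def TwoTensorField.bracket (π : TwoTensorField n M) (f g : M → ℝ) : M → ℝ :=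
  fun x => mvfderiv (𝓡 n) g x (π x (mvfderiv (𝓡 n) f x))

/-- `π` is a Poisson structure: it is skew-symmetric (i.e. a bivector field), smooth, and its
bracket satisfies the Jacobi identity on `C^∞(M)`. -/
structure TwoTensorField.IsPoisson (π : TwoTensorField n M) : Prop where
  skew : ∀ (x : M) (ξ η : TangentSpace (𝓡 n) x →L[ℝ] ℝ), η (π x ξ) = -ξ (π x η)
  smooth : ∀ f g : M → ℝ, ContMDiff (𝓡 n) 𝓘(ℝ, ℝ) ∞ f → ContMDiff (𝓡 n) 𝓘(ℝ, ℝ) ∞ g →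
    ContMDiff (𝓡 n) 𝓘(ℝ, ℝ) ∞ (π.bracket f g)
  jacobi : ∀ f g h : M → ℝ, ContMDiff (𝓡 n) 𝓘(ℝ, ℝ) ∞ f → ContMDiff (𝓡 n) 𝓘(ℝ, ℝ) ∞ g →
    ContMDiff (𝓡 n) 𝓘(ℝ, ℝ) ∞ h →
    π.bracket f (π.bracket g h) + π.bracket g (π.bracket h f) + π.bracket h (π.bracket f g) = 0

end Poisson

/-! ### Linear Dirac geometry: subsets of `V ⊕ V^*` -/

section Dirac

variable {V W : Type*} [AddCommGroup V] [Module ℝ V] [TopologicalSpace V]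
  [AddCommGroup W] [Module ℝ W] [TopologicalSpace W]

/-- `L_π = {π^♯(ξ) + ξ}`. -/
def bivectorGraph (π : (V →L[ℝ] ℝ) →L[ℝ] V) : Set (V × (V →L[ℝ] ℝ)) :=
  {q | q.1 = π q.2}

/-- `L_Ω = {v + ι_v Ω}`. -/
def formGraph (Ω : V [⋀^Fin 2]→L[ℝ] ℝ) : Set (V × (V →L[ℝ] ℝ)) :=
  {q | ∀ w, q.2 w = Ω ![q.1, w]}

/-- The gauge transformation `L^σ = {v + ξ + ι_v σ | v + ξ ∈ L}`. -/
def gaugeTransform (σ : V [⋀^Fin 2]→L[ℝ] ℝ) (L : Set (V × (V →L[ℝ] ℝ))) :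
    Set (V × (V →L[ℝ] ℝ)) :=
  {q | ∃ ξ : V →L[ℝ] ℝ, (q.1, ξ) ∈ L ∧ ∀ w, q.2 w = ξ w + σ ![q.1, w]}

/-- The backward image (pullback) `f^* L = {v + f^* η | f v + η ∈ L}`. -/
def backwardImage (f : V →L[ℝ] W) (L : Set (W × (W →L[ℝ] ℝ))) : Set (V × (V →L[ℝ] ℝ)) :=
  {q | ∃ η : W →L[ℝ] ℝ, (f q.1, η) ∈ L ∧ q.2 = η.comp f}

/-- The forward image (pushforward) `f_* L = {f v + η | v + f^* η ∈ L}`. -/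
def forwardImage (f : V →L[ℝ] W) (L : Set (V × (V →L[ℝ] ℝ))) : Set (W × (W →L[ℝ] ℝ)) :=
  {q | ∃ v : V, f v = q.1 ∧ (v, q.2.comp f) ∈ L}

end Dirac

/-! ### Full dual pairs -/

section DualPair

variable {d n₁ n₂ : ℕ}
  {S : Type*} [TopologicalSpace S] [ChartedSpace (EuclideanSpace ℝ (Fin d)) S]
  {M₁ : Type*} [TopologicalSpace M₁] [ChartedSpace (EuclideanSpace ℝ (Fin n₁)) M₁]
  {M₂ : Type*} [TopologicalSpace M₂] [ChartedSpace (EuclideanSpace ℝ (Fin n₂)) M₂]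

/-- The smooth map `f : (S, Ω) → (M, π)` from a symplectic manifold is a Poisson map. Since `L_Ω`
is the graph of the Poisson structure of `Ω`, this says that `f` is forward Dirac: `f_* L_Ω = L_π`
at every point. -/
def IsPoissonMap (Ω : TwoForm d S) (π : TwoTensorField n₁ M₁) (f : S → M₁) : Prop :=
  ContMDiff (𝓡 d) (𝓡 n₁) ∞ f ∧
  ∀ x : S, forwardImage (mfderiv (𝓡 d) (𝓡 n₁) f x) (formGraph (Ω x)) = bivectorGraph (π (f x))

/-- `(M₁, π₁) ←f₁- (S, Ω) -f₂→ (M₂, π₂)` is a full dual pair: both legs are surjective submersions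
and Poisson maps, and the tangent spaces of their fibres are symplectic orthogonals of one
another. -/
structure IsFullDualPair (Ω : TwoForm d S) (f₁ : S → M₁) (π₁ : TwoTensorField n₁ M₁)
    (f₂ : S → M₂) (π₂ : TwoTensorField n₂ M₂) : Prop where
  symplectic : Ω.IsSymplectic
  submersion_left : Manifold.IsSubmersion (𝓡 d) (𝓡 n₁) ∞ f₁
  submersion_right : Manifold.IsSubmersion (𝓡 d) (𝓡 n₂) ∞ f₂
  surjective_left : Function.Surjective f₁
  surjective_right : Function.Surjective f₂
  poisson_left : IsPoissonMap Ω π₁ f₁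
  poisson_right : IsPoissonMap Ω π₂ f₂
  orthogonal : ∀ (x : S) (v : TangentSpace (𝓡 d) x),
    mfderiv (𝓡 d) (𝓡 n₂) f₂ x v = 0 ↔
      ∀ w : TangentSpace (𝓡 d) x, mfderiv (𝓡 d) (𝓡 n₁) f₁ x w = 0 → Ω x ![v, w] = 0

end DualPair

/-! ### Groupoids -/

/-- A (set-theoretical) groupoid `G ⇉ M`; the product `g h` is defined when `src g = tgt h`. -/
structure Gpd (M G : Type*) where
  src : G → M
  tgt : G → M
  one : M → G
  inv : G → G
  mul : ∀ g h : G, src g = tgt h → G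
  src_one : ∀ x, src (one x) = x
  tgt_one : ∀ x, tgt (one x) = x
  src_inv : ∀ g, src (inv g) = tgt g
  tgt_inv : ∀ g, tgt (inv g) = src g
  src_mul : ∀ g h hgh, src (mul g h hgh) = src h
  tgt_mul : ∀ g h hgh, tgt (mul g h hgh) = tgt g
  one_mul : ∀ g, mul (one (tgt g)) g (src_one _) = g
  mul_one : ∀ g, mul g (one (src g)) (tgt_one _).symm = g
  inv_mul : ∀ g, mul (inv g) g (src_inv g) = one (src g)
  mul_inv : ∀ g, mul g (inv g) (tgt_inv g).symm = one (tgt g)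
  mul_assoc : ∀ g h k hgh hhk,
    mul (mul g h hgh) k ((src_mul g h hgh).trans hhk) =
      mul g (mul h k hhk) (hgh.trans (tgt_mul h k hhk).symm)

namespace Gpd

variable {M G : Type*}

/-- The set `G ×_{s,t} G` of composable pairs. -/
def composable (𝒢 : Gpd M G) : Set (G × G) := {q | 𝒢.src q.1 = 𝒢.tgt q.2}

open Classical in
/-- The multiplication as a map on `G × G`, with irrelevant values outside the composable pairs. -/
noncomputable def mulMap (𝒢 : Gpd M G) (q : G × G) : G :=
  if hq : 𝒢.src q.1 = 𝒢.tgt q.2 then 𝒢.mul q.1 q.2 hq else q.1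

section Smooth

variable {n d : ℕ}
  [TopologicalSpace M] [ChartedSpace (EuclideanSpace ℝ (Fin n)) M]
  [TopologicalSpace G] [ChartedSpace (EuclideanSpace ℝ (Fin d)) G]

variable (n d) in
/-- `𝒢` is a Lie groupoid. The composable pairs form an embedded submanifold of `G × G`, since
`src` is a submersion, so smoothness of the multiplication on this submanifold is the same as
`ContMDiffOn` on this subset of `G × G`. (No separation axiom is required of `G` here; the
separation properties of arrow spaces are carried by their topologies.) -/
structure IsLie (𝒢 : Gpd M G) : Prop where
  src_submersion : Manifold.IsSubmersion (𝓡 d) (𝓡 n) ∞ 𝒢.src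
  tgt_submersion : Manifold.IsSubmersion (𝓡 d) (𝓡 n) ∞ 𝒢.tgt
  one_smooth : ContMDiff (𝓡 n) (𝓡 d) ∞ 𝒢.one
  inv_smooth : ContMDiff (𝓡 d) (𝓡 d) ∞ 𝒢.inv
  mul_smooth : ContMDiffOn ((𝓡 d).prod (𝓡 d)) (𝓡 d) ∞ 𝒢.mulMap 𝒢.composable

variable (n) in
/-- `Ω` is multiplicative: `m^* Ω = pr₁^* Ω + pr₂^* Ω` on `G ×_{s,t} G`. The tangent space of the
composable pairs at `(g, h)` consists of the `(v, w)` with `s_* v = t_* w`, and on it every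
derivative `D` of the multiplication within the composable pairs takes the value `m_* (v, w)`. -/
def IsMultiplicative (𝒢 : Gpd M G) (Ω : TwoForm d G) : Prop :=
  ∀ q ∈ 𝒢.composable,
  ∀ D : TangentSpace ((𝓡 d).prod (𝓡 d)) q →L[ℝ] TangentSpace (𝓡 d) (𝒢.mulMap q),
    HasMFDerivWithinAt ((𝓡 d).prod (𝓡 d)) (𝓡 d) 𝒢.mulMap 𝒢.composable q D →
    ∀ (v v' : TangentSpace (𝓡 d) q.1) (w w' : TangentSpace (𝓡 d) q.2),
      -- values in `TangentSpace (𝓡 n) (src q.1)`, which equals `TangentSpace (𝓡 n) (tgt q.2)`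
      (mfderiv (𝓡 d) (𝓡 n) 𝒢.src q.1 v : EuclideanSpace ℝ (Fin n)) =
        mfderiv (𝓡 d) (𝓡 n) 𝒢.tgt q.2 w →
      (mfderiv (𝓡 d) (𝓡 n) 𝒢.src q.1 v' : EuclideanSpace ℝ (Fin n)) =
        mfderiv (𝓡 d) (𝓡 n) 𝒢.tgt q.2 w' →
      Ω (𝒢.mulMap q) ![D (v, w), D (v', w')] = Ω q.1 ![v, v'] + Ω q.2 ![w, w']

variable (n) in
/-- `(𝒢, Ω)` is a symplectic groupoid. -/
structure IsSymplecticGroupoid (𝒢 : Gpd M G) (Ω : TwoForm d G) : Prop where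
  lie : 𝒢.IsLie n d
  symplectic : Ω.IsSymplectic
  multiplicative : 𝒢.IsMultiplicative n Ω

/-- `(𝒢, Ω)` is a symplectic groupoid integrating `(M, π)`, i.e.
`(M, π) ←s- (G, Ω) -t→ (M, -π)` is a full dual pair. -/
structure Integrates (𝒢 : Gpd M G) (Ω : TwoForm d G) (π : TwoTensorField n M) : Prop where
  symplecticGroupoid : 𝒢.IsSymplecticGroupoid n Ω
  dualPair : IsFullDualPair Ω 𝒢.src π 𝒢.tgt (-π)

end Smooth

/-! ### Pullback groupoids -/

section Pullback

variable {X E : Type*}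

/-- The space of arrows of the pullback groupoid,
`{(e', g, e) | p e' = t g, p e = s g} ⊆ E × G × E`, with the subspace topology. -/
abbrev PullbackArrows (𝒢 : Gpd X G) (p : E → X) : Type _ :=
  {a : E × G × E // p a.1 = 𝒢.tgt a.2.1 ∧ p a.2.2 = 𝒢.src a.2.1}

/-- The pullback groupoid of `𝒢 : G ⇉ X` along `p : E → X`:
`s (e', g, e) = e`, `t (e', g, e) = e'`, `(e'', h, e') (e', g, e) = (e'', h g, e)`. -/
def pullback (𝒢 : Gpd X G) (p : E → X) : Gpd E (𝒢.PullbackArrows p) where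
  src a := a.1.2.2
  tgt a := a.1.1
  one e := ⟨(e, 𝒢.one (p e), e), (𝒢.tgt_one _).symm, (𝒢.src_one _).symm⟩
  inv a := ⟨(a.1.2.2, 𝒢.inv a.1.2.1, a.1.1),
    a.2.2.trans (𝒢.tgt_inv _).symm, a.2.1.trans (𝒢.src_inv _).symm⟩
  mul a b hab := ⟨(a.1.1,
      𝒢.mul a.1.2.1 b.1.2.1 (a.2.2.symm.trans ((congrArg p hab).trans b.2.1)), b.1.2.2),
    a.2.1.trans (𝒢.tgt_mul _ _ _).symm, b.2.2.trans (𝒢.src_mul _ _ _).symm⟩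
  src_one _ := rfl
  tgt_one _ := rfl
  src_inv _ := rfl
  tgt_inv _ := rfl
  src_mul _ _ _ := rfl
  tgt_mul _ _ _ := rfl
  one_mul := by
    rintro ⟨⟨e', g, e⟩, h₁, h₂⟩
    have key : ∀ (x : X) (hx : x = 𝒢.tgt g) (hc : 𝒢.src (𝒢.one x) = 𝒢.tgt g),
        𝒢.mul (𝒢.one x) g hc = g := by
      rintro x rfl hc
      exact 𝒢.one_mul g
    exact Subtype.ext (Prod.ext rfl (Prod.ext (key _ h₁ _) rfl))
  mul_one := by
    rintro ⟨⟨e', g, e⟩, h₁, h₂⟩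
    have key : ∀ (x : X) (hx : x = 𝒢.src g) (hc : 𝒢.src g = 𝒢.tgt (𝒢.one x)),
        𝒢.mul g (𝒢.one x) hc = g := by
      rintro x rfl hc
      exact 𝒢.mul_one g
    exact Subtype.ext (Prod.ext rfl (Prod.ext (key _ h₂ _) rfl))
  inv_mul := by
    rintro ⟨⟨e', g, e⟩, h₁, h₂⟩
    exact Subtype.ext (Prod.ext rfl (Prod.ext
      ((𝒢.inv_mul g).trans (congrArg 𝒢.one h₂.symm)) rfl))
  mul_inv := by
    rintro ⟨⟨e', g, e⟩, h₁, h₂⟩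
    exact Subtype.ext (Prod.ext rfl (Prod.ext
      ((𝒢.mul_inv g).trans (congrArg 𝒢.one h₁.symm)) rfl))
  mul_assoc _ _ _ _ _ := Subtype.ext (Prod.ext rfl (Prod.ext (𝒢.mul_assoc _ _ _ _ _) rfl))

/-- The canonical groupoid map `(e', g, e) ↦ g`. -/
def pullbackProj (𝒢 : Gpd X G) (p : E → X) : 𝒢.PullbackArrows p → G := fun a => a.1.2.1

/-- `Ω_E = 𝐩^* Ω_X + s^* σ - t^* σ` on the pullback groupoid, with respect to a given manifold
structure on its space of arrows. -/
noncomputable def pullbackForm {k d l : ℕ}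
    [TopologicalSpace E] [ChartedSpace (EuclideanSpace ℝ (Fin k)) E]
    [TopologicalSpace G] [ChartedSpace (EuclideanSpace ℝ (Fin d)) G]
    (𝒢 : Gpd X G) (p : E → X) [ChartedSpace (EuclideanSpace ℝ (Fin l)) (𝒢.PullbackArrows p)]
    (ΩX : TwoForm d G) (σ : TwoForm k E) : TwoForm l (𝒢.PullbackArrows p) :=
  TwoForm.pullback (𝒢.pullbackProj p) ΩX + TwoForm.pullback (𝒢.pullback p).src σ
    - TwoForm.pullback (𝒢.pullback p).tgt σ

end Pullback

end Gpd

end SymplGpd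

open scoped Manifold ContDiff

namespace SymplGpd

set_option linter.unusedSectionVars false

open Topology Filter

/-! ### Linear algebra -/

section LinearAlgebra

variable {V : Type*} [NormedAddCommGroup V] [NormedSpace ℝ V]

/-! The arrow space is the fibre product of `E × E` and `G` over `X × X`, and `p` is a submersion.
In charts in which `p` is a linear projection, subtracting lifts of `t(g)` and `s(g)` turns the two
defining equations into the vanishing of `2m` coordinates. This gives slice charts
(`exists_sliceChart`). The dimension is `2k + d - 2m`, and `d = 2m` holds because the tangent spaces
of `G` are symplectic with the orthogonal kernels of `s_*` and `t_*` as subspaces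
(`LinearDualPair.finrank_eq`).

Closedness of the form is naturality of the exterior derivative. It is multiplicative because the
projection to `G` is a groupoid morphism and `s^*σ - t^*σ` telescopes along a product
(`isMultiplicative`).

Everything else is linear algebra at a single arrow. A tangent vector is a triple `(v', u, v)` with
`p_* v' = t_* u` and `p_* v = s_* u`. The key fact is `LinearDualPair.map_of_contract_eq`: if `ι_w
Ω_E = s^*ξ + t^*ξ'`, then `s_* w = π_E ξ` and `t_* w = -π_E ξ'`. To see this, test against triples
`(0, 0, v)` and `(v', 0, 0)`: up to the contractions with `σ`, the covectors `ξ` and `ξ'` descend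
along `p_*`. The `G`-component of `w` then satisfies the analogous equation for `Ω_X`, where the
dual pair of `G` determines its images (`map_left`), and the gauge hypothesis translates the answer
back to `E`. Taking `ξ` or `ξ'` to be zero yields nondegeneracy, both Poisson conditions and the
orthogonality of the fibres (`LinearDualPair.pullback`). Surjectivity of `s_*` and `t_*` then makes
source and target submersions.

Tangent maps are computed on velocities of curves: arrows of the pullback groupoid are assembled
from curves in the factors, and compatible curves are found by lifting along submersions
(`exists_lift_curve`). -/

theorem form_swap (Ω : V [⋀^Fin 2]→L[ℝ] ℝ) (v w : V) : Ω ![v, w] = -Ω ![w, v] := by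
  have h := Ω.toAlternatingMap.map_swap ![w, v] (i := 0) (j := 1) (by decide)
  have h2 : (![w, v] ∘ Equiv.swap (0 : Fin 2) 1) = ![v, w] := by
    ext i; fin_cases i <;> simp
  rw [h2] at h
  exact h

/-- The linear form `ι_v Ω`. -/
noncomputable def contract (Ω : V [⋀^Fin 2]→L[ℝ] ℝ) (v : V) : V →L[ℝ] ℝ :=
  Ω.toContinuousMultilinearMap.toContinuousLinearMap ![v, 0] 1

theorem contract_apply (Ω : V [⋀^Fin 2]→L[ℝ] ℝ) (v w : V) : contract Ω v w = Ω ![v, w] := by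
  simp only [contract, ContinuousMultilinearMap.toContinuousLinearMap]
  change Ω (Function.update ![v, 0] 1 w) = _
  congr 1
  ext i; fin_cases i <;> simp

theorem form_add_left (Ω : V [⋀^Fin 2]→L[ℝ] ℝ) (v v' w : V) :
    Ω ![v + v', w] = Ω ![v, w] + Ω ![v', w] := by
  rw [form_swap, ← contract_apply, map_add, contract_apply, contract_apply, form_swap Ω v,
    form_swap Ω v', neg_add]

theorem form_smul_left (Ω : V [⋀^Fin 2]→L[ℝ] ℝ) (c : ℝ) (v w : V) :
    Ω ![c • v, w] = c * Ω ![v, w] := by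
  rw [form_swap, ← contract_apply, map_smul, contract_apply, form_swap Ω v, smul_eq_mul, mul_neg]

theorem form_zero_right (Ω : V [⋀^Fin 2]→L[ℝ] ℝ) (v : V) : Ω ![v, 0] = 0 := by
  rw [← contract_apply, map_zero]

theorem form_zero_left (Ω : V [⋀^Fin 2]→L[ℝ] ℝ) (w : V) : Ω ![0, w] = 0 := by
  rw [form_swap, form_zero_right, neg_zero]

theorem form_sub_left (Ω : V [⋀^Fin 2]→L[ℝ] ℝ) (v v' w : V) :
    Ω ![v - v', w] = Ω ![v, w] - Ω ![v', w] := by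
  have h := form_add_left Ω (v - v') v' w
  rw [sub_add_cancel] at h
  linarith

/-- The linear map `v ↦ ι_v Ω`. -/
noncomputable def contractₗ (Ω : V [⋀^Fin 2]→L[ℝ] ℝ) : V →ₗ[ℝ] (V →L[ℝ] ℝ) where
  toFun := contract Ω
  map_add' v v' := by ext w; simp [contract_apply, form_add_left]
  map_smul' c v := by ext w; simp [contract_apply, form_smul_left]

variable [FiniteDimensional ℝ V]

/-- A nondegenerate form identifies vectors with covectors. -/
theorem exists_contract_eq {Ω : V [⋀^Fin 2]→L[ℝ] ℝ}
    (hΩ : ∀ v, (∀ w, Ω ![v, w] = 0) → v = 0) (ξ : V →L[ℝ] ℝ) : ∃ v, ∀ w, Ω ![v, w] = ξ w := by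
  have hinj : Function.Injective (contractₗ Ω) := by
    rw [← LinearMap.ker_eq_bot, LinearMap.ker_eq_bot']
    intro v hv
    exact hΩ v fun w => by rw [← contract_apply]; exact congrArg (fun l : V →L[ℝ] ℝ => l w) hv
  have hd : Module.finrank ℝ V = Module.finrank ℝ (V →L[ℝ] ℝ) := by
    rw [← (LinearMap.toContinuousLinearMap (𝕜 := ℝ) (E := V) (F' := ℝ)).finrank_eq]
    exact (Subspace.dual_finrank_eq (K := ℝ) (V := V)).symm
  obtain ⟨v, hv⟩ := (LinearMap.injective_iff_surjective_of_finrank_eq_finrank hd).1 hinj ξ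
  exact ⟨v, fun w => by rw [← contract_apply, ← hv]; rfl⟩

variable {W : Type*} [NormedAddCommGroup W] [NormedSpace ℝ W] [FiniteDimensional ℝ W]

/-- A covector vanishing on the kernel of a surjective map descends along this map. -/
theorem exists_eq_comp_of_ker_le {f : V →L[ℝ] W} (hf : Function.Surjective f) {ξ : V →L[ℝ] ℝ}
    (h : ∀ v, f v = 0 → ξ v = 0) : ∃ η : W →L[ℝ] ℝ, ∀ v, ξ v = η (f v) := by
  obtain ⟨g, hg⟩ := f.toLinearMap.exists_rightInverse_of_surjective (LinearMap.range_eq_top.2 hf)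
  refine ⟨LinearMap.toContinuousLinearMap (ξ.toLinearMap ∘ₗ g), fun v => ?_⟩
  have h1 : f (g (f v)) = f v := congrArg (fun l : W →ₗ[ℝ] W => l (f v)) hg
  have h2 := h (v - g (f v)) (by rw [map_sub, h1, sub_self])
  rw [map_sub, sub_eq_zero] at h2
  exact h2

end LinearAlgebra

/-! ### Linear dual pairs and their pullbacks along surjections with gauge transformations -/

section LinearPullback

variable {V X Y A A' W : Type*}
  [NormedAddCommGroup V] [NormedSpace ℝ V] [FiniteDimensional ℝ V]
  [NormedAddCommGroup X] [NormedSpace ℝ X] [FiniteDimensional ℝ X]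
  [NormedAddCommGroup Y] [NormedSpace ℝ Y] [FiniteDimensional ℝ Y]
  [NormedAddCommGroup A] [NormedSpace ℝ A] [FiniteDimensional ℝ A]
  [NormedAddCommGroup A'] [NormedSpace ℝ A'] [FiniteDimensional ℝ A']
  [NormedAddCommGroup W] [NormedSpace ℝ W] [FiniteDimensional ℝ W]

/-- The infinitesimal version of a full dual pair. -/
structure LinearDualPair (Ω : V [⋀^Fin 2]→L[ℝ] ℝ) (s : V →L[ℝ] X) (π : (X →L[ℝ] ℝ) →L[ℝ] X)
    (t : V →L[ℝ] Y) (π' : (Y →L[ℝ] ℝ) →L[ℝ] Y) : Prop where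
  nondegenerate : ∀ v, (∀ w, Ω ![v, w] = 0) → v = 0
  surjective_left : Function.Surjective s
  surjective_right : Function.Surjective t
  poisson_left : forwardImage s (formGraph Ω) = bivectorGraph π
  poisson_right : forwardImage t (formGraph Ω) = bivectorGraph (-π')
  orthogonal : ∀ v, t v = 0 ↔ ∀ w, s w = 0 → Ω ![v, w] = 0

variable {Ω : V [⋀^Fin 2]→L[ℝ] ℝ} {s : V →L[ℝ] X} {π : (X →L[ℝ] ℝ) →L[ℝ] X}
  {t : V →L[ℝ] Y} {π' : (Y →L[ℝ] ℝ) →L[ℝ] Y}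

namespace LinearDualPair

/-- By nondegeneracy `u` splits as `u₁ - u₂`, where `u₁` represents `s^*η` and `u₂` represents
`t^*η'`. Each half is mapped by one leg according to the Poisson condition and is killed by the
other. -/
theorem map_left (h : LinearDualPair Ω s π t π') {u : V} {η : X →L[ℝ] ℝ} {η' : Y →L[ℝ] ℝ}
    (hu : ∀ w, Ω ![u, w] = η (s w) - η' (t w)) : s u = π η ∧ t u = π' η' := by
  obtain ⟨u₁, hu₁⟩ := exists_contract_eq h.nondegenerate (η.comp s)
  obtain ⟨u₂, hu₂⟩ := exists_contract_eq h.nondegenerate (η'.comp t)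
  have hs : ∀ (ζ : X →L[ℝ] ℝ) v, (∀ w, Ω ![v, w] = ζ.comp s w) → s v = π ζ ∧ t v = 0 := by
    intro ζ v hv
    constructor
    · have : (s v, ζ) ∈ forwardImage s (formGraph Ω) := ⟨v, rfl, fun w => (hv w).symm⟩
      rw [h.poisson_left] at this
      exact this
    · rw [h.orthogonal]
      intro w hw
      simp [hv, hw]
  have ht : t u₂ = -π' η' := by
    have : (t u₂, η') ∈ forwardImage t (formGraph Ω) := ⟨u₂, rfl, fun w => (hu₂ w).symm⟩
    rw [h.poisson_right] at this
    exact this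
  -- Only `ker t = (ker s)^⊥` is assumed, so the opposite relation is obtained by duality: a vector
  -- `v` representing `s^*ζ` lies in `ker t`, hence pairs to zero with `u₂`, although this pairing
  -- is `ζ (s u₂)`.
  have hsu₂ : s u₂ = 0 := by
    by_contra hne
    obtain ⟨ζ, -, hζ⟩ := exists_dual_vector ℝ (s u₂) (norm_ne_zero_iff.2 hne)
    obtain ⟨v, hv⟩ := exists_contract_eq h.nondegenerate (ζ.comp s)
    have h1 := hv u₂
    rw [form_swap, hu₂] at h1
    simp only [ContinuousLinearMap.comp_apply, (hs ζ v hv).2, map_zero, neg_zero, hζ] at h1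
    exact hne (by simpa using h1.symm)
  have hsub : u = u₁ - u₂ := by
    refine sub_eq_zero.1 (h.nondegenerate _ fun w => ?_)
    rw [form_sub_left, form_sub_left, hu, hu₁, hu₂]
    simp
  rw [hsub, map_sub, map_sub, (hs η u₁ hu₁).1, (hs η u₁ hu₁).2, hsu₂, ht]
  simp

variable {p : A →L[ℝ] X} {p' : A' →L[ℝ] Y} {σ : A [⋀^Fin 2]→L[ℝ] ℝ} {σ' : A' [⋀^Fin 2]→L[ℝ] ℝ}
  {πA : (A →L[ℝ] ℝ) →L[ℝ] A} {πA' : (A' →L[ℝ] ℝ) →L[ℝ] A'}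

theorem eq_of_gauge
    (hg : bivectorGraph πA = gaugeTransform σ (backwardImage p (bivectorGraph π)))
    {v : A} {ξ : A →L[ℝ] ℝ} {η : X →L[ℝ] ℝ} (hp : p v = π η)
    (hξ : ∀ w, ξ w = η (p w) + σ ![v, w]) : v = πA ξ := by
  have : (v, ξ) ∈ gaugeTransform σ (backwardImage p (bivectorGraph π)) :=
    ⟨η.comp p, ⟨η, hp, rfl⟩, hξ⟩
  rw [← hg] at this
  exact this

variable {S : W →L[ℝ] A} {T : W →L[ℝ] A'} {P : W →L[ℝ] V} {ΩW : W [⋀^Fin 2]→L[ℝ] ℝ}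

/-- If `ι_w Ω_W = S^* ξ + T^* ξ'` then `S w = π_A ξ` and `T w = - π_{A'} ξ'`. -/
theorem map_of_contract_eq (h : LinearDualPair Ω s π t π')
    (hp : Function.Surjective p) (hp' : Function.Surjective p')
    (hg : bivectorGraph πA = gaugeTransform σ (backwardImage p (bivectorGraph π)))
    (hg' : bivectorGraph πA' = gaugeTransform σ' (backwardImage p' (bivectorGraph π')))
    (hS : ∀ w, p (S w) = s (P w)) (hT : ∀ w, p' (T w) = t (P w))
    (hex : ∀ v' u v, p v = s u → p' v' = t u → ∃ w, T w = v' ∧ P w = u ∧ S w = v)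
    (hΩW : ∀ a b, ΩW ![a, b] = Ω ![P a, P b] + σ ![S a, S b] - σ' ![T a, T b])
    {w₀ : W} {ξ : A →L[ℝ] ℝ} {ξ' : A' →L[ℝ] ℝ}
    (hw : ∀ w, ΩW ![w₀, w] = ξ (S w) + ξ' (T w)) : S w₀ = πA ξ ∧ T w₀ = -πA' ξ' := by
  -- Testing `hw` on the vectors over `(0, 0, v)` with `p v = 0` shows that `ξ - ι σ` vanishes on
  -- `ker p`. The vectors `(v', 0, 0)` do the same for `ξ'`; the signs there come from `- t^*σ'` in
  -- the form.
  obtain ⟨η, hη⟩ := exists_eq_comp_of_ker_le hp (ξ := ξ - contract σ (S w₀)) (by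
    intro v hv
    obtain ⟨w, h1, h2, h3⟩ := hex 0 0 v (by simp [hv]) (by simp)
    have := hw w
    rw [hΩW, h1, h2, h3, form_zero_right, form_zero_right] at this
    simp only [map_zero] at this
    simp only [sub_apply, contract_apply]
    linarith)
  obtain ⟨η', hη'⟩ := exists_eq_comp_of_ker_le hp' (ξ := -ξ' - contract σ' (T w₀)) (by
    intro v hv
    obtain ⟨w, h1, h2, h3⟩ := hex v 0 0 (by simp) (by simp [hv])
    have := hw w
    rw [hΩW, h1, h2, h3, form_zero_right, form_zero_right] at this
    simp only [map_zero] at this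
    simp only [sub_apply, neg_apply, contract_apply]
    linarith)
  simp only [sub_apply, neg_apply, contract_apply] at hη hη'
  -- Every `x` lifts to some `w`, and the gauge terms in `hw` cancel against those absorbed into `η`
  -- and `η'`.
  have hu : ∀ x, Ω ![P w₀, x] = η (s x) - η' (t x) := by
    intro x
    obtain ⟨v, hv⟩ := hp (s x)
    obtain ⟨v', hv'⟩ := hp' (t x)
    obtain ⟨w, h1, h2, h3⟩ := hex v' x v hv hv'
    have := hw w
    rw [hΩW, h1, h2, h3] at this
    have e1 := hη v
    have e2 := hη' v'
    rw [hv] at e1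
    rw [hv'] at e2
    linarith
  obtain ⟨h1, h2⟩ := h.map_left hu
  constructor
  · exact eq_of_gauge hg ((hS w₀).trans h1) fun w => by linarith [hη w]
  · rw [← map_neg]
    refine eq_of_gauge hg' ((hT w₀).trans h2) fun w => ?_
    have := hη' w
    simp only [neg_apply]
    linarith

/-- The linear algebra behind the pullback of a symplectic groupoid: the form on the fibre product
makes the two projections into a dual pair. -/
theorem pullback (h : LinearDualPair Ω s π t π')
    (hp : Function.Surjective p) (hp' : Function.Surjective p')
    (hg : bivectorGraph πA = gaugeTransform σ (backwardImage p (bivectorGraph π)))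
    (hg' : bivectorGraph πA' = gaugeTransform σ' (backwardImage p' (bivectorGraph π')))
    (hS : ∀ w, p (S w) = s (P w)) (hT : ∀ w, p' (T w) = t (P w))
    (hex : ∀ v' u v, p v = s u → p' v' = t u → ∃ w, T w = v' ∧ P w = u ∧ S w = v)
    (hinj : ∀ w, T w = 0 → P w = 0 → S w = 0 → w = 0)
    (hΩW : ∀ a b, ΩW ![a, b] = Ω ![P a, P b] + σ ![S a, S b] - σ' ![T a, T b]) :
    LinearDualPair ΩW S πA T πA' := by
  have key : ∀ (w₀ : W) (ξ : A →L[ℝ] ℝ) (ξ' : A' →L[ℝ] ℝ),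
      (∀ w, ΩW ![w₀, w] = ξ (S w) + ξ' (T w)) → S w₀ = πA ξ ∧ T w₀ = -πA' ξ' :=
    fun _ _ _ hw => h.map_of_contract_eq hp hp' hg hg' hS hT hex hΩW hw
  have hSs : Function.Surjective S := fun v => by
    obtain ⟨u, hu⟩ := h.surjective_left (p v)
    obtain ⟨v', hv'⟩ := hp' (t u)
    obtain ⟨w, -, -, hw⟩ := hex v' u v hu.symm hv'
    exact ⟨w, hw⟩
  have hTs : Function.Surjective T := fun v' => by
    obtain ⟨u, hu⟩ := h.surjective_right (p' v')
    obtain ⟨v, hv⟩ := hp (s u)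
    obtain ⟨w, hw, -, -⟩ := hex v' u v hv hu.symm
    exact ⟨w, hw⟩
  have hnd : ∀ v, (∀ w, ΩW ![v, w] = 0) → v = 0 := by
    intro w₀ hw₀
    obtain ⟨h1, h2⟩ := key w₀ 0 0 (fun w => by simp [hw₀])
    rw [map_zero] at h1
    rw [map_zero, neg_zero] at h2
    refine hinj _ h2 (h.nondegenerate _ fun u => ?_) h1
    obtain ⟨v, hv⟩ := hp (s u)
    obtain ⟨v', hv'⟩ := hp' (t u)
    obtain ⟨w, -, hw, -⟩ := hex v' u v hv hv'
    have := hw₀ w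
    rw [hΩW, h1, h2, hw, form_zero_left, form_zero_left] at this
    linarith
  refine ⟨hnd, hSs, hTs, ?_, ?_, ?_⟩
  · have hsub : ∀ (w : W) (ξ : A →L[ℝ] ℝ), (∀ x, ξ (S x) = ΩW ![w, x]) → S w = πA ξ :=
      fun w ξ hw => (key w ξ 0 (fun x => by simp [hw])).1
    ext ⟨v, ξ⟩
    constructor
    · rintro ⟨w, rfl, hw⟩
      exact hsub w ξ hw
    -- For the reverse inclusion, nondegeneracy produces a vector representing `S^*ξ`, and the
    -- inclusion already shown identifies its image.
    · intro hv
      obtain ⟨w, hw⟩ := exists_contract_eq hnd (ξ.comp S)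
      exact ⟨w, (hsub w ξ fun x => (hw x).symm).trans (Eq.symm hv), fun x => (hw x).symm⟩
  · have hsub : ∀ (w : W) (ξ : A' →L[ℝ] ℝ), (∀ x, ξ (T x) = ΩW ![w, x]) → T w = (-πA') ξ :=
      fun w ξ hw => (key w 0 ξ (fun x => by simp [hw])).2
    ext ⟨v, ξ⟩
    constructor
    · rintro ⟨w, rfl, hw⟩
      exact hsub w ξ hw
    · intro hv
      obtain ⟨w, hw⟩ := exists_contract_eq hnd (ξ.comp T)
      exact ⟨w, (hsub w ξ fun x => (hw x).symm).trans (Eq.symm hv), fun x => (hw x).symm⟩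
  · intro w₀
    constructor
    · intro h0 w hw
      rw [hΩW, h0, hw, form_zero_left, form_zero_right, sub_zero, add_zero]
      refine (h.orthogonal _).1 ?_ _ ?_
      · rw [← hT, h0, map_zero]
      · rw [← hS, hw, map_zero]
    -- A covector `ι ΩW` that vanishes on `ker S` has the form `S^*ξ`, so the key fact applies with
    -- `ξ' = 0`.
    · intro h0
      obtain ⟨ξ, hξ⟩ := exists_eq_comp_of_ker_le hSs (ξ := contract ΩW w₀)
        (fun v hv => by rw [contract_apply, h0 v hv])
      simpa using (key w₀ ξ 0
        (fun x => by simp [← hξ, contract_apply])).2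

/-- The symplectic vector space in a linear dual pair over two spaces of equal dimension has twice
this dimension. -/
theorem finrank_eq (h : LinearDualPair Ω s π t π')
    (hXY : Module.finrank ℝ X = Module.finrank ℝ Y) :
    Module.finrank ℝ V = 2 * Module.finrank ℝ X := by
  have hs := s.toLinearMap.finrank_range_add_finrank_ker
  have ht := t.toLinearMap.finrank_range_add_finrank_ker
  rw [LinearMap.range_eq_top.2 h.surjective_left, finrank_top] at hs
  rw [LinearMap.range_eq_top.2 h.surjective_right, finrank_top] at ht
  let B : LinearMap.BilinForm ℝ V := ContinuousLinearMap.coeLM ℝ ∘ₗ contractₗ Ω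
  have hB : ∀ v w, B v w = Ω ![v, w] := contract_apply Ω
  have hnd : B.Nondegenerate := by
    refine ⟨fun v hv => h.nondegenerate v fun w => ?_, fun v hv => h.nondegenerate v fun w => ?_⟩
    · rw [← hB]; exact hv w
    · rw [form_swap, ← hB, hv w, neg_zero]
  have hrefl : B.IsRefl := fun v w hvw => by rw [hB, form_swap, ← hB, hvw, neg_zero]
  have horth : B.orthogonal (LinearMap.ker s.toLinearMap) = LinearMap.ker t.toLinearMap := by
    ext v
    rw [LinearMap.BilinForm.mem_orthogonal_iff]
    constructor
    · intro hv
      refine (h.orthogonal v).2 fun w hw => ?_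
      rw [form_swap, ← hB, hv w hw, neg_zero]
    · intro hv w hw
      have := (h.orthogonal v).1 hv w hw
      change B w v = 0
      rw [hB, form_swap, this, neg_zero]
  have := LinearMap.BilinForm.finrank_orthogonal hnd (LinearMap.ker s.toLinearMap)
  rw [horth] at this
  -- The orthogonal has dimension `dim V - dim ker s` with truncated subtraction; this bound makes
  -- the subtraction honest.
  have := LinearMap.finrank_le_finrank_of_injective (f := (LinearMap.ker s.toLinearMap).subtype)
    Subtype.val_injective
  omega

end LinearDualPair

end LinearPullback

/-! ### Curves, submersions and immersions -/

section Curves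

variable {E H M E' H' N E'' H'' M'' : Type*}
  [NormedAddCommGroup E] [NormedSpace ℝ E] [TopologicalSpace H] {I : ModelWithCorners ℝ E H}
  [TopologicalSpace M] [ChartedSpace H M]
  [NormedAddCommGroup E'] [NormedSpace ℝ E'] [TopologicalSpace H'] {J : ModelWithCorners ℝ E' H'}
  [TopologicalSpace N] [ChartedSpace H' N]

variable (I) in
/-- The velocity of a curve at time `0`. -/
noncomputable def velocity (γ : ℝ → M) : E := mfderiv 𝓘(ℝ, ℝ) I γ 0 (1 : ℝ)

theorem velocity_congr {γ γ' : ℝ → M} (h : γ =ᶠ[𝓝 0] γ') : velocity I γ = velocity I γ' :=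
  congrArg (fun l : ℝ →L[ℝ] E => l 1) h.mfderiv_eq

theorem velocity_comp {γ : ℝ → M} {f : M → N} {x : M} (hx : γ 0 = x)
    (hf : MDifferentiableAt I J f x) (hγ : MDifferentiableAt 𝓘(ℝ, ℝ) I γ 0) :
    velocity J (f ∘ γ) = mfderiv I J f x (velocity I γ : E) := by
  subst hx
  exact congrArg (fun l : ℝ →L[ℝ] E' => l 1) (mfderiv_comp 0 hf hγ)

theorem velocity_comp_within {γ : ℝ → M} {f : M → N} {s : Set M} {x : M} (hx : γ 0 = x)
    {D : E →L[ℝ] E'} (hf : HasMFDerivWithinAt I J f s x D)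
    (hγ : MDifferentiableAt 𝓘(ℝ, ℝ) I γ 0) (hs : ∀ᶠ τ in 𝓝 0, γ τ ∈ s) :
    velocity J (f ∘ γ) = D (velocity I γ) := by
  subst hx
  have h := (HasMFDerivWithinAt.comp (0 : ℝ) hf
    (hγ.hasMFDerivAt.hasMFDerivWithinAt (s := γ ⁻¹' s)) subset_rfl).hasMFDerivAt hs
  exact congrArg (fun l : ℝ →L[ℝ] E' => l 1) h.mfderiv

theorem mdifferentiableAt_comp_within {γ : ℝ → M} {f : M → N} {s : Set M} {x : M} (hx : γ 0 = x)
    {D : E →L[ℝ] E'} (hf : HasMFDerivWithinAt I J f s x D)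
    (hγ : MDifferentiableAt 𝓘(ℝ, ℝ) I γ 0) (hs : ∀ᶠ τ in 𝓝 0, γ τ ∈ s) :
    MDifferentiableAt 𝓘(ℝ, ℝ) J (f ∘ γ) 0 := by
  subst hx
  exact ((HasMFDerivWithinAt.comp (0 : ℝ) hf
    (hγ.hasMFDerivAt.hasMFDerivWithinAt (s := γ ⁻¹' s)) subset_rfl).hasMFDerivAt
      hs).mdifferentiableAt

theorem velocity_prodMk {γ : ℝ → M} {γ' : ℝ → N} (hγ : MDifferentiableAt 𝓘(ℝ, ℝ) I γ 0)
    (hγ' : MDifferentiableAt 𝓘(ℝ, ℝ) J γ' 0) :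
    velocity (I.prod J) (fun τ => (γ τ, γ' τ)) = (velocity I γ, velocity J γ') :=
  congrArg (fun l : ℝ →L[ℝ] E × E' => l 1) (mfderiv_prodMk hγ hγ')

/-- Every tangent vector is the velocity of a smooth curve. -/
theorem exists_curve [I.Boundaryless] [IsManifold I ∞ M] (x : M) (v : E) :
    ∃ γ : ℝ → M, γ 0 = x ∧ ContMDiffAt 𝓘(ℝ, ℝ) I ∞ γ 0 ∧ velocity I γ = v := by
  have hinv := isInvertible_mfderiv_extChartAt (I := I) (mem_extChartAt_source (I := I) x)
  let w : E := mfderiv I 𝓘(ℝ, E) (extChartAt I x) x v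
  -- A straight line in the chart at `x`; velocities are then compared after applying the
  -- differential of the chart, which is injective.
  let c : ℝ → E := fun τ => extChartAt I x x + τ • w
  have hc0 : c 0 = extChartAt I x x := by simp [c]
  have hc : ContMDiffAt 𝓘(ℝ, ℝ) 𝓘(ℝ, E) ∞ c 0 := by
    rw [contMDiffAt_iff_contDiffAt]
    fun_prop
  have hvel : velocity 𝓘(ℝ, E) c = w := by
    have : HasFDerivAt c (ContinuousLinearMap.toSpanSingleton ℝ w) 0 := by
      have := (ContinuousLinearMap.toSpanSingleton ℝ w).hasFDerivAt (x := (0 : ℝ))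
      exact this.const_add (extChartAt I x x)
    unfold velocity
    rw [mfderiv_eq_fderiv, this.fderiv]
    exact one_smul ℝ w
  have hsymm : ContMDiffAt 𝓘(ℝ, E) I ∞ (extChartAt I x).symm (c 0) := by
    rw [hc0]
    exact (contMDiffOn_extChartAt_symm x).contMDiffAt (extChartAt_target_mem_nhds x)
  have hγ : ContMDiffAt 𝓘(ℝ, ℝ) I ∞ ((extChartAt I x).symm ∘ c) 0 := hsymm.comp 0 hc
  have h0 : ((extChartAt I x).symm ∘ c) 0 = x := by simp [hc0]
  refine ⟨(extChartAt I x).symm ∘ c, h0, hγ, hinv.injective ?_⟩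
  rw [← velocity_comp (J := 𝓘(ℝ, E)) h0 (mdifferentiableAt_extChartAt (mem_chart_source H x))
    (hγ.mdifferentiableAt (by simp))]
  change velocity 𝓘(ℝ, E) (extChartAt I x ∘ (extChartAt I x).symm ∘ c) = w
  refine (velocity_congr ?_).trans hvel
  have : ∀ᶠ τ in 𝓝 (0 : ℝ), c τ ∈ (extChartAt I x).target :=
    hc.continuousAt (by rw [hc0]; exact extChartAt_target_mem_nhds x)
  filter_upwards [this] with τ hτ
  exact (extChartAt I x).right_inv hτ

variable {F : Type*} [NormedAddCommGroup F] [NormedSpace ℝ F]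

open Manifold in
/-- A submersion admits a smooth family of local sections through the points of its domain. -/
theorem exists_local_sections [I.Boundaryless] [J.Boundaryless] {f : M → N} {x : M}
    (hf : IsSubmersionAtOfComplement F I J ∞ f x) :
    ∃ h : N × M → M, ContMDiffAt (J.prod I) I ∞ h (f x, x) ∧
      (∀ᶠ x' in 𝓝 x, h (f x', x') = x') ∧ ∀ᶠ q in 𝓝 (f x, x), f (h q) = q.1 := by
  let φ := hf.domChart.extend I
  let ψ := hf.codChart.extend J
  let L := hf.equiv
  have hφs : φ.source ∈ 𝓝 x := by
    rw [OpenPartialHomeomorph.extend_source]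
    exact hf.domChart.open_source.mem_nhds hf.mem_domChart_source
  have hx : x ∈ φ.source := mem_of_mem_nhds hφs
  have hψs : ψ.source ∈ 𝓝 (f x) := by
    rw [OpenPartialHomeomorph.extend_source]
    exact hf.codChart.open_source.mem_nhds hf.mem_codChart_source
  have hφt : φ.target ∈ 𝓝 (φ x) :=
    hf.domChart.isOpen_extend_target.mem_nhds (φ.map_source hx)
  have hmap : ∀ y ∈ φ.source, f y ∈ ψ.source := by
    intro y hy
    rw [OpenPartialHomeomorph.extend_source] at hy ⊢
    exact hf.source_subset_preimage_source hy
  have hw : ∀ u ∈ φ.target, ψ (f (φ.symm u)) = (L u).1 := fun u hu => hf.writtenInCharts hu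
  -- In adapted charts `f` is the projection to the first component, so the section over `y` through
  -- `x'` keeps the fibre coordinate of `x'` and takes its base coordinate from `y`.
  let k : N × M → E := fun q => L.symm (ψ q.1, (L (φ q.2)).2)
  have hk : ∀ x' ∈ φ.source, k (f x', x') = φ x' := by
    intro x' hx'
    have := hw (φ x') (φ.map_source hx')
    rw [φ.left_inv hx'] at this
    simp [k, this]
  have hφsm : ContMDiffAt I 𝓘(ℝ, E) ∞ φ x :=
    hf.domChart.contMDiffAt_extend hf.domChart_mem_maximalAtlas hf.mem_domChart_source
  have hψsm : ContMDiffAt J 𝓘(ℝ, E') ∞ ψ (f x) :=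
    hf.codChart.contMDiffAt_extend hf.codChart_mem_maximalAtlas hf.mem_codChart_source
  have hksm : ContMDiffAt (J.prod I) 𝓘(ℝ, E) ∞ k (f x, x) := by
    have h1 : ContMDiffAt (J.prod I) 𝓘(ℝ, E') ∞ (fun q : N × M => ψ q.1) (f x, x) :=
      ContMDiffAt.comp (f x, x) (g := ψ) (f := Prod.fst) hψsm contMDiffAt_fst
    have h2 : ContMDiffAt (J.prod I) 𝓘(ℝ, E) ∞ (fun q : N × M => φ q.2) (f x, x) :=
      ContMDiffAt.comp (f x, x) (g := φ) (f := Prod.snd) hφsm contMDiffAt_snd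
    have h3 : ContDiff ℝ ∞ (fun z : E' × E => L.symm (z.1, (L z.2).2)) := by fun_prop
    exact ContMDiffAt.comp (f x, x) (I' := 𝓘(ℝ, E' × E))
      (g := fun z : E' × E => L.symm (z.1, (L z.2).2)) (f := fun q : N × M => (ψ q.1, φ q.2))
      h3.contMDiff.contMDiffAt (h1.prodMk_space h2)
  have hsymm : ContMDiffAt 𝓘(ℝ, E) I ∞ φ.symm (k (f x, x)) := by
    rw [hk x hx]
    refine (contMDiffOn_extend_symm hf.domChart_mem_maximalAtlas).contMDiffAt ?_
    rw [← hf.domChart.extend_target']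
    exact hφt
  refine ⟨fun q => φ.symm (k q), hsymm.comp (f x, x) hksm, ?_, ?_⟩
  · filter_upwards [hφs] with x' hx'
    rw [hk x' hx', φ.left_inv hx']
  · have h1 : ∀ᶠ q in 𝓝 (f x, x), k q ∈ φ.target :=
      hksm.continuousAt (by rw [hk x hx]; exact hφt)
    have h2 : ∀ᶠ q : N × M in 𝓝 (f x, x), q.1 ∈ ψ.source :=
      (continuous_fst.tendsto (f x, x)) hψs
    filter_upwards [h1, h2] with q hq1 hq2
    refine ψ.injOn (hmap _ (φ.map_target hq1)) hq2 ?_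
    rw [hw _ hq1]
    simp [k]

open Manifold in
/-- Curves can be lifted along submersions, with any prescribed compatible velocity. -/
theorem exists_lift_curve [I.Boundaryless] [J.Boundaryless] [IsManifold I ∞ M] {f : M → N} {x : M}
    (hf : IsSubmersionAtOfComplement F I J ∞ f x) {c : ℝ → N} (hc0 : c 0 = f x)
    (hc : ContMDiffAt 𝓘(ℝ, ℝ) J ∞ c 0) {v : E} (hv : mfderiv I J f x v = velocity J c) :
    ∃ γ : ℝ → M, γ 0 = x ∧ ContMDiffAt 𝓘(ℝ, ℝ) I ∞ γ 0 ∧ velocity I γ = v ∧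
      f ∘ γ =ᶠ[𝓝 0] c := by
  obtain ⟨h, hh, h1, h2⟩ := exists_local_sections hf
  obtain ⟨γ, hγ0, hγ, hγv⟩ := exists_curve (I := I) x v
  have hfx := hf.contMDiffAt
  have hγd := hγ.mdifferentiableAt (by simp)
  have hcγ : ContMDiffAt 𝓘(ℝ, ℝ) (J.prod I) ∞ (fun τ => (c τ, γ τ)) 0 := hc.prodMk hγ
  have h0 : (fun τ => (c τ, γ τ)) 0 = (f x, x) := by simp [hc0, hγ0]
  have hx : h (f x, x) = x := h1.self_of_nhds
  have hfγ : ContMDiffAt 𝓘(ℝ, ℝ) (J.prod I) ∞ (fun τ => (f (γ τ), γ τ)) 0 := by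
    refine ContMDiffAt.prodMk ?_ hγ
    exact ContMDiffAt.comp (0 : ℝ) (g := f) (by rw [hγ0]; exact hfx) hγ
  have h0' : (fun τ => (f (γ τ), γ τ)) 0 = (f x, x) := by simp [hγ0]
  -- An arbitrary curve `γ` with velocity `v` is moved into the fibres over `c`. The velocity is
  -- unchanged: it depends only on the velocities of `c` and `γ`, which agree with those of `f ∘ γ`
  -- and `γ`, and `h (f x', x') = x'`.
  refine ⟨h ∘ fun τ => (c τ, γ τ), by simp [hc0, hγ0, hx], ?_, ?_, ?_⟩
  · refine ContMDiffAt.comp (0 : ℝ) ?_ hcγ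
    rw [← h0] at hh
    exact hh
  · rw [velocity_comp h0 (hh.mdifferentiableAt (by simp)) (hcγ.mdifferentiableAt (by simp)),
      velocity_prodMk (hc.mdifferentiableAt (by simp)) hγd, ← hv, ← hγv,
      ← velocity_comp hγ0 (hfx.mdifferentiableAt (by simp)) hγd]
    have : h ∘ (fun τ => (f (γ τ), γ τ)) =ᶠ[𝓝 0] γ := by
      have hlim : Tendsto γ (𝓝 0) (𝓝 x) := by
        have := hγ.continuousAt.tendsto
        rwa [hγ0] at this
      exact hlim.eventually h1
    conv_rhs => rw [← velocity_congr (I := I) this]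
    rw [velocity_comp h0' (hh.mdifferentiableAt (by simp)) (hfγ.mdifferentiableAt (by simp))]
    congr 1
    refine (velocity_prodMk ?_ hγd).symm
    exact MDifferentiableAt.comp (0 : ℝ) (by rw [hγ0]; exact hfx.mdifferentiableAt (by simp)) hγd
  · have hlim : Tendsto (fun τ => (c τ, γ τ)) (𝓝 0) (𝓝 (f x, x)) := by
      have := hcγ.continuousAt.tendsto
      exact h0 ▸ this
    exact hlim.eventually h2

-- A curve in `N` with a given velocity is moved to `M` by the local section through `x`.
open Manifold in
theorem mfderiv_surjective_of_submersion [I.Boundaryless] [J.Boundaryless] [IsManifold J ∞ N]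
    {f : M → N} {x : M} (hf : IsSubmersionAtOfComplement F I J ∞ f x) :
    Function.Surjective (mfderiv I J f x) := by
  intro v
  obtain ⟨h, hh, h1, h2⟩ := exists_local_sections hf
  obtain ⟨c, hc0, hc, hcv⟩ := exists_curve (I := J) (f x) v
  have hx : h (f x, x) = x := h1.self_of_nhds
  have hcx : ContMDiffAt 𝓘(ℝ, ℝ) (J.prod I) ∞ (fun τ => (c τ, x)) 0 :=
    hc.prodMk contMDiffAt_const
  have h0 : (fun τ => (c τ, x)) 0 = (f x, x) := by simp [hc0]
  have hγ : ContMDiffAt 𝓘(ℝ, ℝ) I ∞ (h ∘ fun τ => (c τ, x)) 0 := by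
    refine ContMDiffAt.comp (0 : ℝ) ?_ hcx
    rw [← h0] at hh
    exact hh
  refine ⟨(velocity I (h ∘ fun τ => (c τ, x)) : E), ?_⟩
  rw [← velocity_comp (by simp [hc0, hx]) (hf.contMDiffAt.mdifferentiableAt (by simp))
    (hγ.mdifferentiableAt (by simp))]
  change velocity J (f ∘ h ∘ fun τ => (c τ, x)) = v
  refine (velocity_congr ?_).trans hcv
  have hlim : Tendsto (fun τ => (c τ, x)) (𝓝 0) (𝓝 (f x, x)) := by
    have := hcx.continuousAt.tendsto
    exact h0 ▸ this
  exact hlim.eventually h2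

open Manifold in
/-- An immersion has smooth local left inverses. -/
theorem exists_left_inverse_of_immersion [I.Boundaryless] {f : M → N} {x : M}
    (hf : IsImmersionAtOfComplement F I J ∞ f x) :
    ∃ h : N → M, ContMDiffAt J I ∞ h (f x) ∧ ∀ᶠ y in 𝓝 x, h (f y) = y := by
  let φ := hf.domChart.extend I
  let ψ := hf.codChart.extend J
  let L := hf.equiv
  have hφs : φ.source ∈ 𝓝 x := by
    rw [OpenPartialHomeomorph.extend_source]
    exact hf.domChart.open_source.mem_nhds hf.mem_domChart_source
  have hx : x ∈ φ.source := mem_of_mem_nhds hφs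
  have hφt : φ.target ∈ 𝓝 (φ x) :=
    hf.domChart.isOpen_extend_target.mem_nhds (φ.map_source hx)
  have hw : ∀ y ∈ φ.source, (L.symm (ψ (f y))).1 = φ y := by
    intro y hy
    have : ψ (f (φ.symm (φ y))) = L (φ y, 0) := hf.writtenInCharts (φ.map_source hy)
    rw [φ.left_inv hy] at this
    simp [this]
  -- In adapted charts `f` is `y ↦ (y, 0)`, and projecting to the first component inverts it.
  let h : N → M := fun z => φ.symm (L.symm (ψ z)).1
  have hψ : ContMDiffAt J 𝓘(ℝ, E') ∞ ψ (f x) :=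
    hf.codChart.contMDiffAt_extend hf.codChart_mem_maximalAtlas hf.mem_codChart_source
  have hsymm : ContMDiffAt 𝓘(ℝ, E) I ∞ φ.symm ((L.symm (ψ (f x))).1) := by
    rw [hw x hx]
    refine (contMDiffOn_extend_symm hf.domChart_mem_maximalAtlas).contMDiffAt ?_
    rw [← hf.domChart.extend_target']
    exact hφt
  have hlin : ContDiff ℝ ∞ (fun z : E' => (L.symm z).1) := by fun_prop
  have hh : ContMDiffAt J I ∞ h (f x) :=
    hsymm.comp (f x) (hlin.contMDiff.contMDiffAt.comp (f x) hψ)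
  refine ⟨h, hh, ?_⟩
  filter_upwards [hφs] with y hy
  simp only [h, hw y hy, φ.left_inv hy]

open Manifold in
theorem mfderiv_injective_of_immersion [I.Boundaryless] {f : M → N} {x : M}
    (hf : IsImmersionAtOfComplement F I J ∞ f x) : Function.Injective (mfderiv I J f x) := by
  obtain ⟨h, hh, hid⟩ := exists_left_inverse_of_immersion hf
  have hd := mfderiv_comp x (hh.mdifferentiableAt (by simp))
    (hf.contMDiffAt.mdifferentiableAt (by simp))
  have hid' : h ∘ f =ᶠ[𝓝 x] id := hid
  rw [hid'.mfderiv_eq, mfderiv_id] at hd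
  intro v w hvw
  have hv := congrArg (fun l : E →L[ℝ] E => l v) hd
  have hw := congrArg (fun l : E →L[ℝ] E => l w) hd
  refine Eq.trans hv (Eq.trans ?_ hw.symm)
  exact congrArg (mfderiv J I h (f x)) hvw

open Manifold in
/-- Smoothness of a continuous map can be tested after composition with an immersion. -/
theorem contMDiffWithinAt_of_comp_immersion [TopologicalSpace H''] [NormedAddCommGroup E'']
    [NormedSpace ℝ E''] {I'' : ModelWithCorners ℝ E'' H''} [TopologicalSpace M'']
    [ChartedSpace H'' M''] [I.Boundaryless] {f : M → N} {g : M'' → M} {s : Set M''} {z : M''}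
    (hf : IsImmersionAtOfComplement F I J ∞ f (g z)) (hz : z ∈ s)
    (hg : ContinuousWithinAt g s z) (hfg : ContMDiffWithinAt I'' J ∞ (f ∘ g) s z) :
    ContMDiffWithinAt I'' I ∞ g s z := by
  obtain ⟨h, hh, hid⟩ := exists_left_inverse_of_immersion hf
  have h1 : ContMDiffWithinAt I'' I ∞ (h ∘ f ∘ g) s z := hh.comp_contMDiffWithinAt z hfg
  refine h1.congr_of_eventuallyEq_of_mem ?_ hz
  -- Continuity of `g` keeps its values where the local left inverse is valid.
  filter_upwards [hg.eventually hid] with y hy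
  exact hy.symm

end Curves

/-! ### Maps with surjective differentials are submersions -/

section Submersion

variable {E E' F : Type*} [NormedAddCommGroup E] [NormedSpace ℝ E] [FiniteDimensional ℝ E]
  [NormedAddCommGroup E'] [NormedSpace ℝ E'] [FiniteDimensional ℝ E']
  [NormedAddCommGroup F] [NormedSpace ℝ F] [FiniteDimensional ℝ F]

/-- A surjective linear map is the first component of an isomorphism onto a product. -/
theorem exists_equiv_prod_of_surjective (f : E →L[ℝ] E') (hf : Function.Surjective f)
    (hF : Module.finrank ℝ E' + Module.finrank ℝ F = Module.finrank ℝ E) :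
    ∃ L : E ≃L[ℝ] E' × F, ∀ v, (L v).1 = f v := by
  have hker := f.toLinearMap.finrank_range_add_finrank_ker
  rw [LinearMap.range_eq_top.2 hf, finrank_top] at hker
  let e : LinearMap.ker f.toLinearMap ≃ₗ[ℝ] F := LinearEquiv.ofFinrankEq _ _ (by omega)
  obtain ⟨r, hr⟩ := (LinearMap.ker f.toLinearMap).subtype.exists_leftInverse_of_injective
    (Submodule.ker_subtype _)
  let l : E →ₗ[ℝ] E' × F := f.toLinearMap.prod (e.toLinearMap ∘ₗ r)
  have hl : Function.Injective l := by
    rw [← LinearMap.ker_eq_bot, LinearMap.ker_eq_bot']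
    intro v hv
    have h1 : f v = 0 := congrArg Prod.fst hv
    have h2 : e (r v) = 0 := congrArg Prod.snd hv
    have h3 : r v = ⟨v, h1⟩ := congrArg (fun g => g ⟨v, h1⟩) hr
    rw [h3, map_eq_zero_iff e e.injective] at h2
    exact congrArg Subtype.val h2
  exact ⟨(LinearEquiv.ofInjectiveOfFinrankEq l hl (by simp [hF])).toContinuousLinearEquiv,
    fun _ => rfl⟩

variable {M N : Type*} [TopologicalSpace M] [ChartedSpace E M] [IsManifold 𝓘(ℝ, E) ∞ M]
  [TopologicalSpace N] [ChartedSpace E' N] [IsManifold 𝓘(ℝ, E') ∞ N]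

/-- A smooth map with invertible differential at a point restricts to a diffeomorphism between
open subsets. -/
theorem exists_local_diffeo {Φ : E → E} {a : E} (hsm : ∀ᶠ y in 𝓝 a, ContDiffAt ℝ ∞ Φ y)
    (hinv : (fderiv ℝ Φ a).IsInvertible) {U : Set E} (hU : U ∈ 𝓝 a) :
    ∃ e : OpenPartialHomeomorph E E, a ∈ e.source ∧ e.source ⊆ U ∧ ⇑e = Φ ∧
      ContDiffOn ℝ ∞ e e.source ∧ ContDiffOn ℝ ∞ e.symm e.target := by
  have hΦ := hsm.self_of_nhds
  obtain ⟨A, hA⟩ := hinv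
  have hd : HasFDerivAt Φ (A : E →L[ℝ] E) a := by
    rw [hA]
    exact (hΦ.differentiableAt (by simp)).hasFDerivAt
  let e := hΦ.toOpenPartialHomeomorph Φ hd (by simp)
  have hi : ∀ᶠ y in 𝓝 a, (fderiv ℝ Φ y).IsInvertible := by
    have hc : ContinuousAt (fderiv ℝ Φ) a := (hΦ.fderiv_right (m := 0) (by simp)).continuousAt
    refine hc (ContinuousLinearEquiv.isOpen.mem_nhds ?_)
    exact ⟨A, hA⟩
  -- The source is shrunk until `Φ` is smooth with invertible differential at every point, not only
  -- at `a`, so that the inverse is smooth on the whole target.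
  obtain ⟨s, hs, hso, has⟩ := mem_nhds_iff.1 (inter_mem hU (inter_mem hsm hi))
  have hsrc : (e.restr s).source = e.source ∩ s := by
    rw [OpenPartialHomeomorph.restr_source, hso.interior_eq]
  refine ⟨e.restr s, ?_, ?_, rfl, ?_, ?_⟩
  · rw [hsrc]
    exact ⟨hΦ.mem_toOpenPartialHomeomorph_source hd (by simp), has⟩
  · rw [hsrc]
    exact fun y hy => (hs hy.2).1
  · rw [hsrc]
    intro y hy
    have : ContDiffAt ℝ ∞ Φ y := (hs hy.2).2.1
    exact this.contDiffWithinAt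
  · intro u hu
    have hy : (e.restr s).symm u ∈ e.source ∩ s := hsrc ▸ (e.restr s).map_target hu
    obtain ⟨-, hy1, hy2⟩ := hs hy.2
    obtain ⟨B, hB⟩ := hy2
    replace hy1 : ContDiffAt ℝ ∞ Φ ((e.restr s).symm u) := hy1
    refine ((e.restr s).contDiffAt_symm (f₀' := B) hu ?_ hy1).contDiffWithinAt
    rw [hB]
    exact (hy1.differentiableAt (by simp)).hasFDerivAt

open Manifold in
/-- A smooth map is a submersion at the points where its differential is surjective. -/
theorem isSubmersionAt_of_mfderiv_surjective {f : M → N} {x : M}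
    (hf : ContMDiff 𝓘(ℝ, E) 𝓘(ℝ, E') ∞ f)
    (hx : Function.Surjective (mfderiv 𝓘(ℝ, E) 𝓘(ℝ, E') f x))
    (hF : Module.finrank ℝ E' + Module.finrank ℝ F = Module.finrank ℝ E) :
    IsSubmersionAtOfComplement F 𝓘(ℝ, E) 𝓘(ℝ, E') ∞ f x := by
  let φ := chartAt E x
  let ψ := chartAt E' (f x)
  let g : E → E' := ψ ∘ f ∘ φ.symm
  have hxφ : x ∈ φ.source := mem_chart_source E x
  have hfψ : f x ∈ ψ.source := mem_chart_source E' (f x)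
  have hφx : φ x ∈ φ.target := φ.map_source hxφ
  have hUo : φ.target ∩ (f ∘ φ.symm) ⁻¹' ψ.source ∈ 𝓝 (φ x) := by
    refine inter_mem (φ.open_target.mem_nhds hφx) ?_
    have hc : ContinuousAt (f ∘ φ.symm) (φ x) :=
      hf.continuous.continuousAt.comp (φ.continuousAt_symm hφx)
    refine hc (ψ.open_source.mem_nhds ?_)
    simpa only [Function.comp_apply, φ.left_inv hxφ] using hfψ
  have hg : ∀ᶠ y in 𝓝 (φ x), ContDiffAt ℝ ∞ g y := by
    filter_upwards [hUo] with y hy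
    rw [← contMDiffAt_iff_contDiffAt]
    have h1 : ContMDiffAt 𝓘(ℝ, E) 𝓘(ℝ, E) ∞ φ.symm y :=
      contMDiffAt_symm_of_mem_maximalAtlas (IsManifold.chart_mem_maximalAtlas x) hy.1
    have h2 : ContMDiffAt 𝓘(ℝ, E') 𝓘(ℝ, E') ∞ ψ ((f ∘ φ.symm) y) :=
      contMDiffAt_of_mem_maximalAtlas (IsManifold.chart_mem_maximalAtlas (f x)) hy.2
    exact ContMDiffAt.comp y (g := ψ) (f := f ∘ φ.symm) h2 ((hf _).comp _ h1)
  obtain ⟨A, hA, hgx⟩ : ∃ A : E →L[ℝ] E', Function.Surjective A ∧ HasFDerivAt g A (φ x) := by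
    refine ⟨mfderiv 𝓘(ℝ, E) 𝓘(ℝ, E') f x, hx, ?_⟩
    have h := (hf.mdifferentiable (by simp) x).hasMFDerivAt.2
    refine hasFDerivWithinAt_univ.1 ?_
    have hr : Set.range 𝓘(ℝ, E) = Set.univ := by simp
    rw [hr] at h
    exact h
  obtain ⟨L, hL⟩ := exists_equiv_prod_of_surjective (F := F) A hA hF
  -- This coordinate change replaces the linear first component `A` of `L` by `g` itself. Its
  -- differential at `φ x` is the identity, so it is a local diffeomorphism, and after it `f` reads
  -- as the first component of `L`.
  let Φ : E → E := fun y => L.symm (g y, (L y).2)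
  have hΦ : ∀ᶠ y in 𝓝 (φ x), ContDiffAt ℝ ∞ Φ y := by
    filter_upwards [hg] with y hy
    have : ContDiff ℝ ∞ (fun z : E' × E => L.symm (z.1, (L z.2).2)) := by fun_prop
    exact ContDiffAt.comp y (g := fun z : E' × E => L.symm (z.1, (L z.2).2))
      (f := fun y => (g y, y)) this.contDiffAt (hy.prodMk contDiffAt_id)
  have hΦd : HasFDerivAt Φ (ContinuousLinearMap.id ℝ E) (φ x) := by
    have h2 : HasFDerivAt (fun y => (L y).2) ((ContinuousLinearMap.snd ℝ E' F).comp
        (L : E →L[ℝ] E' × F)) (φ x) :=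
      ((ContinuousLinearMap.snd ℝ E' F).comp (L : E →L[ℝ] E' × F)).hasFDerivAt
    have h3 := (L.symm : E' × F →L[ℝ] E).hasFDerivAt.comp (φ x) (hgx.prodMk h2)
    refine h3.congr_fderiv ?_
    ext v
    rw [ContinuousLinearMap.comp_apply, ContinuousLinearMap.prod_apply, ← hL]
    exact L.symm_apply_apply v
  obtain ⟨e, hae, heU, heΦ, hes, het⟩ := exists_local_diffeo hΦ
    (by rw [hΦd.fderiv]; exact ⟨ContinuousLinearEquiv.refl ℝ E, rfl⟩) hUo
  have hmem : φ.trans e ∈ IsManifold.maximalAtlas 𝓘(ℝ, E) ∞ M := by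
    have hφ := IsManifold.chart_mem_maximalAtlas (I := 𝓘(ℝ, E)) (n := ∞) x
    refine OpenPartialHomeomorph.mem_maximalAtlas_of_contMDiffOn _ ?_ ?_
    · refine (contMDiffOn_iff_contDiffOn.2 hes).comp
        ((contMDiffOn_of_mem_maximalAtlas hφ).mono fun y hy => ?_) fun y hy => ?_
      · exact (OpenPartialHomeomorph.trans_source φ e ▸ hy).1
      · exact (OpenPartialHomeomorph.trans_source φ e ▸ hy).2
    · refine (contMDiffOn_symm_of_mem_maximalAtlas hφ).comp
        ((contMDiffOn_iff_contDiffOn.2 het).mono fun y hy => ?_) fun y hy => ?_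
      · exact (OpenPartialHomeomorph.trans_target φ e ▸ hy).1
      · exact (OpenPartialHomeomorph.trans_target φ e ▸ hy).2
  refine IsSubmersionAtOfComplement.mk_of_continuousAt hf.continuous.continuousAt L (φ.trans e) ψ
    ?_ hfψ hmem (IsManifold.chart_mem_maximalAtlas (f x)) ?_
  · rw [OpenPartialHomeomorph.trans_source]
    exact ⟨hxφ, hae⟩
  · intro u hu
    have hu' : u ∈ e.target := by
      have : u ∈ (φ.trans e).target := by simpa using hu
      exact (OpenPartialHomeomorph.trans_target φ e ▸ this).1
    have h1 : Φ (e.symm u) = u := by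
      rw [← heΦ]
      exact e.right_inv hu'
    have h2 : (L (Φ (e.symm u))).1 = g (e.symm u) := by simp [Φ]
    rw [h1] at h2
    simpa [g] using h2.symm

end Submersion

/-! ### Embedded submanifolds given by slice charts -/

section Slice

variable {E H N B C : Type*} [NormedAddCommGroup E] [NormedSpace ℝ E] [TopologicalSpace H]
  {I : ModelWithCorners ℝ E H} [TopologicalSpace N] [ChartedSpace H N]
  [NormedAddCommGroup B] [NormedSpace ℝ B] [NormedAddCommGroup C] [NormedSpace ℝ C]

variable (B C I) in
/-- A slice chart of the subset `{x | P x}` of `N`. -/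
structure SliceChart (P : N → Prop) where
  chart : OpenPartialHomeomorph N H
  mem_maximalAtlas : chart ∈ IsManifold.maximalAtlas I ∞ N
  equiv : E ≃L[ℝ] B × C
  slice : ∀ x ∈ chart.source, P x ↔ (equiv (chart.extend I x)).2 = 0

namespace SliceChart

variable {P : N → Prop}

open Classical in
/-- The chart of the subset `{x | P x}` obtained from a slice chart. -/
noncomputable def toChart [I.Boundaryless] (Θ : SliceChart B C I P) (a₀ : {x // P x}) :
    OpenPartialHomeomorph {x // P x} B where
  toFun a := (Θ.equiv (Θ.chart.extend I a.1)).1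
  invFun u := if h : P ((Θ.chart.extend I).symm (Θ.equiv.symm (u, 0))) then ⟨_, h⟩ else a₀
  source := Subtype.val ⁻¹' Θ.chart.source
  target := {u | Θ.equiv.symm (u, 0) ∈ (Θ.chart.extend I).target}
  map_source' a ha := by
    have h1 := (Θ.slice a.1 ha).1 a.2
    have h2 : ((Θ.equiv (Θ.chart.extend I a.1)).1, (0 : C)) = Θ.equiv (Θ.chart.extend I a.1) :=
      Prod.ext rfl h1.symm
    rw [Set.mem_ofPred_eq]
    rw [h2, Θ.equiv.symm_apply_apply]
    exact (Θ.chart.extend I).map_source (by rwa [OpenPartialHomeomorph.extend_source])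
  map_target' u hu := by
    have h1 := (Θ.chart.extend I).map_target hu
    rw [OpenPartialHomeomorph.extend_source] at h1
    have h2 : P ((Θ.chart.extend I).symm (Θ.equiv.symm (u, 0))) := by
      rw [Θ.slice _ h1, (Θ.chart.extend I).right_inv hu, Θ.equiv.apply_symm_apply]
    rw [dif_pos h2]
    exact h1
  left_inv' a ha := by
    have h1 := (Θ.slice a.1 ha).1 a.2
    have h2 : ((Θ.equiv (Θ.chart.extend I a.1)).1, (0 : C)) = Θ.equiv (Θ.chart.extend I a.1) :=
      Prod.ext rfl h1.symm
    have h3 : (Θ.chart.extend I).symm (Θ.equiv.symm ((Θ.equiv (Θ.chart.extend I a.1)).1, 0)) =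
        a.1 := by
      rw [h2, Θ.equiv.symm_apply_apply]
      exact (Θ.chart.extend I).left_inv (by rwa [OpenPartialHomeomorph.extend_source])
    simp only [h3, a.2, dif_pos, Subtype.eta]
  right_inv' u hu := by
    have h1 := (Θ.chart.extend I).map_target hu
    rw [OpenPartialHomeomorph.extend_source] at h1
    have h2 : P ((Θ.chart.extend I).symm (Θ.equiv.symm (u, 0))) := by
      rw [Θ.slice _ h1, (Θ.chart.extend I).right_inv hu, Θ.equiv.apply_symm_apply]
    rw [dif_pos h2, (Θ.chart.extend I).right_inv hu, Θ.equiv.apply_symm_apply]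
  open_source := Θ.chart.open_source.preimage continuous_subtype_val
  open_target := Θ.chart.isOpen_extend_target.preimage (by fun_prop)
  continuousOn_toFun := by
    refine (continuous_fst.comp Θ.equiv.continuous).comp_continuousOn ?_
    refine (Θ.chart.continuousOn_extend (I := I)).comp continuous_subtype_val.continuousOn ?_
    intro a ha
    rwa [OpenPartialHomeomorph.extend_source]
  continuousOn_invFun := by
    rw [IsEmbedding.subtypeVal.isInducing.continuousOn_iff]
    refine ContinuousOn.congr (f := fun u => (Θ.chart.extend I).symm (Θ.equiv.symm (u, 0))) ?_ ?_
    · exact (Θ.chart.continuousOn_extend_symm (I := I)).comp (by fun_prop) fun u hu => hu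
    · intro u hu
      have h1 := (Θ.chart.extend I).map_target hu
      rw [OpenPartialHomeomorph.extend_source] at h1
      have h2 : P ((Θ.chart.extend I).symm (Θ.equiv.symm (u, 0))) := by
        rw [Θ.slice _ h1, (Θ.chart.extend I).right_inv hu, Θ.equiv.apply_symm_apply]
      simp only [Function.comp_apply, dif_pos h2]

variable [I.Boundaryless]

theorem toChart_apply (Θ : SliceChart B C I P) (a₀ a : {x // P x}) :
    Θ.toChart a₀ a = (Θ.equiv (Θ.chart.extend I a.1)).1 := rfl

theorem val_toChart_symm (Θ : SliceChart B C I P) (a₀ : {x // P x}) {u : B}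
    (hu : u ∈ (Θ.toChart a₀).target) :
    ((Θ.toChart a₀).symm u).1 = (Θ.chart.extend I).symm (Θ.equiv.symm (u, 0)) := by
  have h1 := (Θ.chart.extend I).map_target hu
  rw [OpenPartialHomeomorph.extend_source] at h1
  have h2 : P ((Θ.chart.extend I).symm (Θ.equiv.symm (u, 0))) := by
    rw [Θ.slice _ h1, (Θ.chart.extend I).right_inv hu, Θ.equiv.apply_symm_apply]
  change (dite (h := Classical.propDecidable _) _ _ _ : {x // P x}).1 = _
  rw [dif_pos h2]

/-- The charted space structure defined by slice charts. -/
@[reducible]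
noncomputable def chartedSpace (Θ : {x // P x} → SliceChart B C I P)
    (hΘ : ∀ a, a.1 ∈ (Θ a).chart.source) : ChartedSpace B {x // P x} where
  atlas := Set.range fun a => (Θ a).toChart a
  chartAt a := (Θ a).toChart a
  mem_chart_source := hΘ
  chart_mem_atlas a := ⟨a, rfl⟩

/-- The coordinate change is that of the ambient charts, restricted to the slice `B × 0` and
projected to `B`. -/
theorem contDiffOn_coordChange (Θ Θ' : SliceChart B C I P) (a a' : {x // P x}) :
    ContDiffOn ℝ ∞ (Θ'.toChart a' ∘ (Θ.toChart a).symm)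
      ((Θ.toChart a).symm.trans (Θ'.toChart a')).source := by
  have h := I.contDiffOn_extendCoordChange Θ.mem_maximalAtlas
    Θ'.mem_maximalAtlas
  have hs : ∀ u ∈ ((Θ.toChart a).symm.trans (Θ'.toChart a')).source,
      Θ.equiv.symm (u, 0) ∈ (I.extendCoordChange Θ.chart Θ'.chart).source := by
    intro u hu
    rw [OpenPartialHomeomorph.trans_source] at hu
    have h1 : ((Θ.toChart a).symm u).1 ∈ Θ'.chart.source := hu.2
    rw [val_toChart_symm Θ a hu.1] at h1
    rw [ModelWithCorners.extendCoordChange, PartialEquiv.trans_source]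
    refine ⟨hu.1, ?_⟩
    rw [Set.mem_preimage, OpenPartialHomeomorph.extend_source]
    exact h1
  have h2 : ContDiffOn ℝ ∞ (fun u : B => (Θ'.equiv ((I.extendCoordChange Θ.chart Θ'.chart)
      (Θ.equiv.symm (u, 0)))).1) ((Θ.toChart a).symm.trans (Θ'.toChart a')).source := by
    have h3 : ContDiff ℝ ∞ (fun u : B => Θ.equiv.symm (u, (0 : C))) := by fun_prop
    have h4 : ContDiff ℝ ∞ (fun z : E => (Θ'.equiv z).1) := by fun_prop
    exact h4.comp_contDiffOn (h.comp h3.contDiffOn hs)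
  refine h2.congr fun u hu => ?_
  rw [OpenPartialHomeomorph.trans_source] at hu
  rw [Function.comp_apply, toChart_apply, val_toChart_symm Θ a hu.1]
  rfl

theorem isManifold (Θ : {x // P x} → SliceChart B C I P)
    (hΘ : ∀ a, a.1 ∈ (Θ a).chart.source) :
    letI := chartedSpace Θ hΘ
    IsManifold 𝓘(ℝ, B) ∞ {x // P x} := by
  let _ := chartedSpace Θ hΘ
  refine isManifold_of_contDiffOn _ _ _ ?_
  rintro _ _ ⟨a, rfl⟩ ⟨a', rfl⟩
  simpa using contDiffOn_coordChange (Θ a) (Θ a') a a'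

-- In a slice chart and its ambient chart the inclusion reads `u ↦ (u, 0)`, which is the normal form
-- of an immersion; the topology is the subspace topology by construction.
open Manifold in
theorem isSmoothEmbedding (Θ : {x // P x} → SliceChart B C I P)
    (hΘ : ∀ a, a.1 ∈ (Θ a).chart.source) :
    letI := chartedSpace Θ hΘ
    IsSmoothEmbedding 𝓘(ℝ, B) I ∞ (Subtype.val : {x // P x} → N) := by
  let _ := chartedSpace Θ hΘ
  have := isManifold Θ hΘ
  have himm : IsImmersionOfComplement C 𝓘(ℝ, B) I ∞ (Subtype.val : {x // P x} → N) := by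
    intro a
    refine IsImmersionAtOfComplement.mk_of_continuousAt continuous_subtype_val.continuousAt
      (Θ a).equiv.symm ((Θ a).toChart a) (Θ a).chart (hΘ a) (hΘ a)
      (IsManifold.chart_mem_maximalAtlas a) (Θ a).mem_maximalAtlas ?_
    intro u hu
    have hu' : u ∈ ((Θ a).toChart a).target := by simpa using hu
    have h1 : ((((Θ a).toChart a).extend 𝓘(ℝ, B)).symm u).1 =
        ((Θ a).chart.extend I).symm ((Θ a).equiv.symm (u, 0)) := by
      simpa using val_toChart_symm (Θ a) a hu'
    rw [Function.comp_apply, Function.comp_apply, h1, ((Θ a).chart.extend I).right_inv hu']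
    rfl
  exact ⟨himm.isImmersion, IsEmbedding.subtypeVal⟩

end SliceChart

end Slice

/-! ### Pullbacks of smooth and of closed two-forms -/

section FormCalculus

variable {E E' Z : Type*} [NormedAddCommGroup E] [NormedSpace ℝ E] [FiniteDimensional ℝ E]
  [NormedAddCommGroup E'] [NormedSpace ℝ E']
  [NormedAddCommGroup Z] [NormedSpace ℝ Z]

/-- Smoothness of a family of two-forms can be tested on pairs of vectors. -/
theorem contDiffAt_form {α : Z → E [⋀^Fin 2]→L[ℝ] ℝ} {z : Z}
    (h : ∀ m : Fin 2 → E, ContDiffAt ℝ ∞ (fun y => α y m) z) : ContDiffAt ℝ ∞ α z := by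
  let b := Module.finBasis ℝ E
  -- Evaluation on pairs of basis vectors embeds the forms linearly in a finite-dimensional space. A
  -- linear left inverse is continuous there and recovers the form.
  let ev : (E [⋀^Fin 2]→L[ℝ] ℝ) →ₗ[ℝ] ((Fin 2 → Fin (Module.finrank ℝ E)) → ℝ) :=
    { toFun := fun β i => β (b ∘ i)
      map_add' := fun _ _ => rfl
      map_smul' := fun _ _ => rfl }
  have hev : LinearMap.ker ev = ⊥ := by
    rw [LinearMap.ker_eq_bot']
    intro β hβ
    refine ContinuousAlternatingMap.toAlternatingMap_injective ?_
    refine b.ext_alternating fun i _ => ?_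
    exact congrFun hβ i
  obtain ⟨r, hr⟩ := ev.exists_leftInverse_of_injective hev
  have h1 : ContDiffAt ℝ ∞ (fun y => ev (α y)) z := contDiffAt_pi.2 fun i => h _
  have h2 := (LinearMap.toContinuousLinearMap r).contDiff.contDiffAt.comp z h1
  refine h2.congr_of_eventuallyEq (Eventually.of_forall fun y => ?_)
  exact (congrArg (fun l => l (α y)) hr).symm

/-- The expression is linear in the form and continuous multilinear in the two copies of `A`. -/
theorem contDiffAt_compContinuousLinearMap {α : Z → E' [⋀^Fin 2]→L[ℝ] ℝ} {A : Z → E →L[ℝ] E'}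
    {z : Z} (hα : ContDiffAt ℝ ∞ α z) (hA : ContDiffAt ℝ ∞ A z) :
    ContDiffAt ℝ ∞ (fun y => (α y).compContinuousLinearMap (A y)) z := by
  refine contDiffAt_form fun m => ?_
  let Φ := ContinuousMultilinearMap.compContinuousLinearMapContinuousMultilinear ℝ
    (fun _ : Fin 2 => E) (fun _ : Fin 2 => E') ℝ
  have hΦ : ContDiff ℝ ∞ Φ := by apply ContinuousMultilinearMap.contDiff
  have hA' : ContDiffAt ℝ ∞ (fun y => fun _ : Fin 2 => A y) z := contDiffAt_pi.2 fun _ => hA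
  have h1 : ContDiffAt ℝ ∞ (fun y => Φ (fun _ => A y)) z := hΦ.contDiffAt.comp z hA'
  have hJ : ContDiff ℝ ∞ (fun β : E' [⋀^Fin 2]→L[ℝ] ℝ => β.toContinuousMultilinearMap) :=
    (ContinuousAlternatingMap.toContinuousMultilinearMapCLM (𝕜 := ℝ) (E := E') (F := ℝ)
      (ι := Fin 2) ℝ).contDiff
  have h2 : ContDiffAt ℝ ∞ (fun y => (α y).toContinuousMultilinearMap) z := hJ.contDiffAt.comp z hα
  exact (ContinuousMultilinearMap.apply ℝ (fun _ : Fin 2 => E) ℝ m).contDiff.contDiffAt.comp z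
    (h1.clm_apply h2)

end FormCalculus

theorem two_le_smooth : minSmoothness ℝ 2 ≤ (∞ : WithTop ℕ∞) := by
  rw [minSmoothness_of_isRCLikeNormedField]
  exact ENat.LEInfty.out

/-! ### Two-forms in the charts of a manifold -/

section Forms

variable {n n' : ℕ}
  {M : Type*} [TopologicalSpace M] [ChartedSpace (EuclideanSpace ℝ (Fin n)) M]
  [IsManifold (𝓡 n) ∞ M]
  {N : Type*} [TopologicalSpace N] [ChartedSpace (EuclideanSpace ℝ (Fin n')) N]
  [IsManifold (𝓡 n') ∞ N]

/-- A form as a form on the model space. -/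
abbrev TwoForm.toModel (Ω : TwoForm n M) (x : M) :
    EuclideanSpace ℝ (Fin n) [⋀^Fin 2]→L[ℝ] ℝ := Ω x

/-- The pullback of a form in charts. -/
theorem TwoForm.inChart_pullback {f : M → N} (hf : ContMDiff (𝓡 n) (𝓡 n') ∞ f) (Ω : TwoForm n' N)
    (x₀ : M) (y₀ : N) {y : EuclideanSpace ℝ (Fin n)} (hy : y ∈ (extChartAt (𝓡 n) x₀).target)
    (hfy : f ((extChartAt (𝓡 n) x₀).symm y) ∈ (extChartAt (𝓡 n') y₀).source) :
    (TwoForm.pullback f Ω).inChart x₀ y =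
      (Ω.inChart y₀
          ((extChartAt (𝓡 n') y₀ ∘ f ∘ (extChartAt (𝓡 n) x₀).symm) y)).compContinuousLinearMap
        (fderiv ℝ (extChartAt (𝓡 n') y₀ ∘ f ∘ (extChartAt (𝓡 n) x₀).symm) y) := by
  set c := extChartAt (𝓡 n) x₀ with hc
  set c' := extChartAt (𝓡 n') y₀ with hc'
  set F := c' ∘ f ∘ c.symm with hF
  have hct : c.target ∈ 𝓝 y := (isOpen_extChartAt_target x₀).mem_nhds hy
  have h1 : ContMDiffAt 𝓘(ℝ, EuclideanSpace ℝ (Fin n)) (𝓡 n) ∞ c.symm y :=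
    (contMDiffOn_extChartAt_symm x₀).contMDiffAt hct
  have h2 : ContMDiffAt 𝓘(ℝ, EuclideanSpace ℝ (Fin n)) (𝓡 n') ∞ (f ∘ c.symm) y := (hf _).comp y h1
  have h3 : ContMDiffAt (𝓡 n') 𝓘(ℝ, EuclideanSpace ℝ (Fin n')) ∞ c' (f (c.symm y)) :=
    contMDiffAt_extChartAt' (by rwa [hc', extChartAt_source] at hfy)
  have h4 : ContMDiffAt 𝓘(ℝ, EuclideanSpace ℝ (Fin n)) 𝓘(ℝ, EuclideanSpace ℝ (Fin n')) ∞ F y :=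
    ContMDiffAt.comp y (g := c') (f := f ∘ c.symm) h3 h2
  have hFt : F y ∈ c'.target := c'.map_source hfy
  have h5 : ContMDiffAt 𝓘(ℝ, EuclideanSpace ℝ (Fin n')) (𝓡 n') ∞ c'.symm (F y) :=
    (contMDiffOn_extChartAt_symm y₀).contMDiffAt ((isOpen_extChartAt_target y₀).mem_nhds hFt)
  have hev : c'.symm ∘ F =ᶠ[𝓝 y] f ∘ c.symm := by
    have : ∀ᶠ z in 𝓝 y, (f ∘ c.symm) z ∈ c'.source :=
      h2.continuousAt ((isOpen_extChartAt_source y₀).mem_nhds hfy)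
    filter_upwards [this] with z hz
    exact c'.left_inv hz
  have hd1 := mfderiv_comp y (h5.mdifferentiableAt (by simp)) (h4.mdifferentiableAt (by simp))
  have hd2 := mfderiv_comp y ((hf (c.symm y)).mdifferentiableAt (by simp))
    (h1.mdifferentiableAt (by simp))
  rw [hev.mfderiv_eq, hd2, mfderiv_eq_fderiv] at hd1
  have hpt : c'.symm (F y) = f (c.symm y) := hev.self_of_nhds
  ext m
  -- Viewed on the model space, the forms at the two base points have the same type, so the base
  -- point can be rewritten.
  change Ω.toModel (f (c.symm y)) (fun i => _) = Ω.toModel (c'.symm (F y)) (fun i => _)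
  rw [hpt]
  congr 1
  funext i
  exact congrArg (fun l : EuclideanSpace ℝ (Fin n) →L[ℝ] EuclideanSpace ℝ (Fin n') => l (m i)) hd1

theorem contDiffAt_inCharts {f : M → N} (hf : ContMDiff (𝓡 n) (𝓡 n') ∞ f)
    (x₀ : M) (y₀ : N) {y : EuclideanSpace ℝ (Fin n)} (hy : y ∈ (extChartAt (𝓡 n) x₀).target)
    (hfy : f ((extChartAt (𝓡 n) x₀).symm y) ∈ (extChartAt (𝓡 n') y₀).source) :
    ContDiffAt ℝ ∞ (extChartAt (𝓡 n') y₀ ∘ f ∘ (extChartAt (𝓡 n) x₀).symm) y := by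
  rw [← contMDiffAt_iff_contDiffAt]
  have h1 : ContMDiffAt 𝓘(ℝ, EuclideanSpace ℝ (Fin n)) (𝓡 n) ∞ (extChartAt (𝓡 n) x₀).symm y :=
    (contMDiffOn_extChartAt_symm x₀).contMDiffAt ((isOpen_extChartAt_target x₀).mem_nhds hy)
  have h3 : ContMDiffAt (𝓡 n') 𝓘(ℝ, EuclideanSpace ℝ (Fin n')) ∞ (extChartAt (𝓡 n') y₀)
      (f ((extChartAt (𝓡 n) x₀).symm y)) :=
    contMDiffAt_extChartAt' (by rwa [extChartAt_source] at hfy)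
  exact ContMDiffAt.comp y (g := extChartAt (𝓡 n') y₀) (f := f ∘ (extChartAt (𝓡 n) x₀).symm) h3
    ((hf _).comp y h1)

/-- Near each point, the pullback of a form reads as the pullback between model spaces. -/
theorem TwoForm.inChart_pullback_eventuallyEq {f : M → N} (hf : ContMDiff (𝓡 n) (𝓡 n') ∞ f)
    (Ω : TwoForm n' N) (x₀ : M) {y : EuclideanSpace ℝ (Fin n)}
    (hy : y ∈ (extChartAt (𝓡 n) x₀).target) :
    ∃ (y₀ : N) (F : EuclideanSpace ℝ (Fin n) → EuclideanSpace ℝ (Fin n')), ContDiffAt ℝ ∞ F y ∧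
      F y ∈ (extChartAt (𝓡 n') y₀).target ∧ ContDiffAt ℝ ∞ (fderiv ℝ F) y ∧
      (TwoForm.pullback f Ω).inChart x₀ =ᶠ[𝓝 y]
        fun z => (Ω.inChart y₀ (F z)).compContinuousLinearMap (fderiv ℝ F z) := by
  have hfy := mem_extChartAt_source (I := 𝓡 n') (f ((extChartAt (𝓡 n) x₀).symm y))
  have hF := contDiffAt_inCharts hf x₀ _ hy hfy
  refine ⟨_, _, hF, (extChartAt (𝓡 n') _).map_source hfy, hF.fderiv_right (by simp), ?_⟩
  have hct := (isOpen_extChartAt_target (I := 𝓡 n) x₀).mem_nhds hy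
  have h1 : ContinuousAt (f ∘ (extChartAt (𝓡 n) x₀).symm) y :=
    hf.continuous.continuousAt.comp
      ((continuousOn_extChartAt_symm x₀).continuousAt hct)
  have h2 : ∀ᶠ z in 𝓝 y, (f ∘ (extChartAt (𝓡 n) x₀).symm) z ∈ (extChartAt (𝓡 n') _).source :=
    h1 ((isOpen_extChartAt_source _).mem_nhds hfy)
  filter_upwards [hct, h2] with z hz hz'
  exact TwoForm.inChart_pullback hf Ω x₀ _ hz hz'

theorem TwoForm.IsSmooth.contDiffAt {Ω : TwoForm n M} (h : Ω.IsSmooth) (x₀ : M)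
    {y : EuclideanSpace ℝ (Fin n)} (hy : y ∈ (extChartAt (𝓡 n) x₀).target) :
    ContDiffAt ℝ ∞ (Ω.inChart x₀) y :=
  (h x₀).contDiffAt ((isOpen_extChartAt_target x₀).mem_nhds hy)

theorem TwoForm.IsSmooth.pullback {f : M → N} (hf : ContMDiff (𝓡 n) (𝓡 n') ∞ f)
    {Ω : TwoForm n' N} (h : Ω.IsSmooth) : (TwoForm.pullback (n := n) f Ω).IsSmooth := by
  intro x₀ y hy
  obtain ⟨y₀, F, hF, hFy, hF', he⟩ := TwoForm.inChart_pullback_eventuallyEq hf Ω x₀ hy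
  refine (ContDiffAt.congr_of_eventuallyEq ?_ he).contDiffWithinAt
  exact contDiffAt_compContinuousLinearMap ((h.contDiffAt y₀ hFy).comp y hF) hF'

/-- The exterior derivative is local and commutes with pullback between model spaces; smoothness of
the form supplies the differentiability that this needs. -/
theorem TwoForm.IsClosed.pullback {f : M → N} (hf : ContMDiff (𝓡 n) (𝓡 n') ∞ f)
    {Ω : TwoForm n' N} (hs : Ω.IsSmooth) (h : Ω.IsClosed) :
    (TwoForm.pullback (n := n) f Ω).IsClosed := by
  intro x₀ y hy
  obtain ⟨y₀, F, hF, hFy, hF', he⟩ := TwoForm.inChart_pullback_eventuallyEq hf Ω x₀ hy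
  rw [he.extDeriv_eq, extDeriv_pullback ((hs.contDiffAt y₀ hFy).differentiableAt (by simp)) hF
    two_le_smooth, h y₀ _ hFy]
  rfl

theorem TwoForm.IsSmooth.add {Ω Ω' : TwoForm n M} (h : Ω.IsSmooth) (h' : Ω'.IsSmooth) :
    (Ω + Ω').IsSmooth :=
  fun x₀ => (h x₀).add (h' x₀)

theorem TwoForm.IsSmooth.sub {Ω Ω' : TwoForm n M} (h : Ω.IsSmooth) (h' : Ω'.IsSmooth) :
    (Ω - Ω').IsSmooth :=
  fun x₀ => (h x₀).sub (h' x₀)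

theorem TwoForm.IsClosed.add {Ω Ω' : TwoForm n M} (hs : Ω.IsSmooth) (hs' : Ω'.IsSmooth)
    (h : Ω.IsClosed) (h' : Ω'.IsClosed) : (Ω + Ω').IsClosed := by
  intro x₀ y hy
  have := extDeriv_add ((hs.contDiffAt x₀ hy).differentiableAt (by simp))
    ((hs'.contDiffAt x₀ hy).differentiableAt (by simp))
  rw [h x₀ y hy, h' x₀ y hy, add_zero] at this
  exact this

theorem TwoForm.IsClosed.sub {Ω Ω' : TwoForm n M} (hs : Ω.IsSmooth) (hs' : Ω'.IsSmooth)
    (h : Ω.IsClosed) (h' : Ω'.IsClosed) : (Ω - Ω').IsClosed := by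
  intro x₀ y hy
  have h1 : extDeriv (Ω.inChart x₀ - Ω'.inChart x₀) y =
      extDeriv (Ω.inChart x₀) y - extDeriv (Ω'.inChart x₀) y := by
    have := extDeriv_add ((hs.contDiffAt x₀ hy).differentiableAt (by simp))
      (((hs'.contDiffAt x₀ hy).differentiableAt (by simp)).const_smul (-1 : ℝ))
    rw [extDeriv_smul, neg_one_smul ℝ (Ω'.inChart x₀), neg_one_smul, ← sub_eq_add_neg,
      ← sub_eq_add_neg] at this
    exact this
  rw [h x₀ y hy, h' x₀ y hy, sub_zero] at h1
  exact h1

end Forms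

/-! ### The manifold of arrows of a pullback groupoid -/

section Shear

variable {A D B : Type*} [NormedAddCommGroup A] [NormedSpace ℝ A] [NormedAddCommGroup D]
  [NormedSpace ℝ D] [NormedAddCommGroup B] [NormedSpace ℝ B]

/-- The shear `(a, y, b) ↦ (a - α y, y, b - β y)`. -/
def shear (W : Set D) (hW : IsOpen W) (α : D → A) (β : D → B) (hα : ContinuousOn α W)
    (hβ : ContinuousOn β W) : OpenPartialHomeomorph (A × D × B) (A × D × B) where
  toFun q := (q.1 - α q.2.1, q.2.1, q.2.2 - β q.2.1)
  invFun q := (q.1 + α q.2.1, q.2.1, q.2.2 + β q.2.1)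
  source := {q | q.2.1 ∈ W}
  target := {q | q.2.1 ∈ W}
  map_source' _ h := h
  map_target' _ h := h
  left_inv' _ _ := by simp
  right_inv' _ _ := by simp
  open_source := hW.preimage (continuous_fst.comp continuous_snd)
  open_target := hW.preimage (continuous_fst.comp continuous_snd)
  continuousOn_toFun := by
    have h1 : ContinuousOn (fun q : A × D × B => α q.2.1) {q | q.2.1 ∈ W} :=
      hα.comp (continuous_fst.comp continuous_snd).continuousOn fun _ h => h
    have h2 : ContinuousOn (fun q : A × D × B => β q.2.1) {q | q.2.1 ∈ W} :=
      hβ.comp (continuous_fst.comp continuous_snd).continuousOn fun _ h => h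
    exact (continuous_fst.continuousOn.sub h1).prodMk
      ((continuous_fst.comp continuous_snd).continuousOn.prodMk
        ((continuous_snd.comp continuous_snd).continuousOn.sub h2))
  continuousOn_invFun := by
    have h1 : ContinuousOn (fun q : A × D × B => α q.2.1) {q | q.2.1 ∈ W} :=
      hα.comp (continuous_fst.comp continuous_snd).continuousOn fun _ h => h
    have h2 : ContinuousOn (fun q : A × D × B => β q.2.1) {q | q.2.1 ∈ W} :=
      hβ.comp (continuous_fst.comp continuous_snd).continuousOn fun _ h => h
    exact (continuous_fst.continuousOn.add h1).prodMk
      ((continuous_fst.comp continuous_snd).continuousOn.prodMk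
        ((continuous_snd.comp continuous_snd).continuousOn.add h2))

/-- The inverse is the shear with the opposite sign, so both directions are smooth. Hence product
charts may be followed by a shear within the maximal atlas. -/
theorem shear_mem_groupoid {W : Set D} (hW : IsOpen W) {α : D → A} {β : D → B}
    (hα : ContDiffOn ℝ ∞ α W) (hβ : ContDiffOn ℝ ∞ β W) :
    (shear W hW α β hα.continuousOn hβ.continuousOn :
      OpenPartialHomeomorph (ModelProd A (ModelProd D B)) (ModelProd A (ModelProd D B))) ∈
      contDiffGroupoid ∞ (𝓘(ℝ, A).prod (𝓘(ℝ, D).prod 𝓘(ℝ, B))) := by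
  have h1 : ContDiffOn ℝ ∞ (fun q : A × D × B => α q.2.1) {q | q.2.1 ∈ W} :=
    hα.comp (contDiff_fst.comp contDiff_snd).contDiffOn fun _ h => h
  have h2 : ContDiffOn ℝ ∞ (fun q : A × D × B => β q.2.1) {q | q.2.1 ∈ W} :=
    hβ.comp (contDiff_fst.comp contDiff_snd).contDiffOn fun _ h => h
  rw [contDiffGroupoid, mem_groupoid_of_pregroupoid]
  constructor
  · have h3 : ContDiffOn ℝ ∞ (fun q : A × D × B => (q.1 - α q.2.1, q.2.1, q.2.2 - β q.2.1))
        {q | q.2.1 ∈ W} :=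
      (contDiff_fst.contDiffOn.sub h1).prodMk
        ((contDiff_fst.comp contDiff_snd).contDiffOn.prodMk
          ((contDiff_snd.comp contDiff_snd).contDiffOn.sub h2))
    exact h3.mono fun q hq => hq.1
  · have h3 : ContDiffOn ℝ ∞ (fun q : A × D × B => (q.1 + α q.2.1, q.2.1, q.2.2 + β q.2.1))
        {q | q.2.1 ∈ W} :=
      (contDiff_fst.contDiffOn.add h1).prodMk
        ((contDiff_fst.comp contDiff_snd).contDiffOn.prodMk
          ((contDiff_snd.comp contDiff_snd).contDiffOn.add h2))
    exact h3.mono fun q hq => hq.1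

end Shear

theorem trans_mem_maximalAtlas {E H M : Type*} [NormedAddCommGroup E] [NormedSpace ℝ E]
    [TopologicalSpace H] {I : ModelWithCorners ℝ E H} [TopologicalSpace M] [ChartedSpace H M]
    {e : OpenPartialHomeomorph M H} (he : e ∈ IsManifold.maximalAtlas I ∞ M)
    {s : OpenPartialHomeomorph H H} (hs : s ∈ contDiffGroupoid ∞ I) :
    e.trans s ∈ IsManifold.maximalAtlas I ∞ M := by
  intro e' he'
  obtain ⟨h1, h2⟩ := he e' he'
  constructor
  · rw [OpenPartialHomeomorph.trans_symm_eq_symm_trans_symm, OpenPartialHomeomorph.trans_assoc]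
    exact (contDiffGroupoid ∞ I).trans ((contDiffGroupoid ∞ I).symm hs) h1
  · rw [← OpenPartialHomeomorph.trans_assoc]
    exact (contDiffGroupoid ∞ I).trans h2 hs

section SplittingEquiv

variable {A A' K K' D B R : Type*}
  [NormedAddCommGroup A] [NormedSpace ℝ A] [FiniteDimensional ℝ A]
  [NormedAddCommGroup A'] [NormedSpace ℝ A'] [FiniteDimensional ℝ A']
  [NormedAddCommGroup K] [NormedSpace ℝ K] [NormedAddCommGroup K'] [NormedSpace ℝ K']
  [NormedAddCommGroup D] [NormedSpace ℝ D] [FiniteDimensional ℝ D]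
  [NormedAddCommGroup B] [NormedSpace ℝ B] [NormedAddCommGroup R] [NormedSpace ℝ R]
  [FiniteDimensional ℝ R]

/-- The isomorphism separating the components along `B` from those along a fibre product. -/
theorem exists_splitting (L' : A' ≃L[ℝ] B × K') (L : A ≃L[ℝ] B × K)
    (hR : Module.finrank ℝ R + 2 * Module.finrank ℝ B =
      Module.finrank ℝ A' + Module.finrank ℝ D + Module.finrank ℝ A) :
    ∃ Λ : (A' × D × A) ≃L[ℝ] R × (B × B), ∀ q, (Λ q).2 = ((L' q.1).1, (L q.2.2).1) := by
  let f : (A' × D × A) →L[ℝ] B × B :=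
    ((ContinuousLinearMap.fst ℝ B K').comp ((L' : A' →L[ℝ] B × K').comp
      (ContinuousLinearMap.fst ℝ _ _))).prod
    ((ContinuousLinearMap.fst ℝ B K).comp ((L : A →L[ℝ] B × K).comp
      ((ContinuousLinearMap.snd ℝ _ _).comp (ContinuousLinearMap.snd ℝ _ _))))
  have hf : Function.Surjective f := by
    rintro ⟨b, b'⟩
    exact ⟨(L'.symm (b, 0), 0, L.symm (b', 0)), by simp [f]⟩
  have : FiniteDimensional ℝ (B × K) := L.toLinearEquiv.finiteDimensional
  have : FiniteDimensional ℝ B :=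
    Module.Finite.of_surjective (LinearMap.fst ℝ B K) LinearMap.fst_surjective
  obtain ⟨Λ, hΛ⟩ := exists_equiv_prod_of_surjective (F := R) f hf
    (by simp only [Module.finrank_prod]; omega)
  exact ⟨Λ.trans (ContinuousLinearEquiv.prodComm ℝ _ _), hΛ⟩

end SplittingEquiv

section Arrows

open Manifold

variable {m k d : ℕ}
  {X : Type*} [TopologicalSpace X] [ChartedSpace (EuclideanSpace ℝ (Fin m)) X]
  [IsManifold (𝓡 m) ∞ X]
  {E : Type*} [TopologicalSpace E] [ChartedSpace (EuclideanSpace ℝ (Fin k)) E]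
  [IsManifold (𝓡 k) ∞ E]
  {G : Type*} [TopologicalSpace G] [ChartedSpace (EuclideanSpace ℝ (Fin d)) G]
  [IsManifold (𝓡 d) ∞ G]

variable {F : Type*} [NormedAddCommGroup F] [NormedSpace ℝ F]

/-- In adapted charts, `p x = y` is a linear condition. -/
theorem eq_iff_of_submersion {p : E → X} {e : E}
    (hp : IsSubmersionAtOfComplement F (𝓡 k) (𝓡 m) ∞ p e) {e₁ : E} (he₁ : e₁ ∈ hp.domChart.source)
    {x : X} (hx : x ∈ hp.codChart.source) :
    p e₁ = x ↔ (hp.equiv (hp.domChart e₁ - hp.equiv.symm (hp.codChart x, 0))).1 = 0 := by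
  have h1 : hp.codChart (p e₁) = (hp.equiv (hp.domChart e₁)).1 := by
    have ht : hp.domChart e₁ ∈ (hp.domChart.extend (𝓡 k)).target := by
      simpa using hp.domChart.map_source he₁
    have := hp.writtenInCharts ht
    simpa [hp.domChart.left_inv he₁] using this
  rw [map_sub, ContinuousLinearEquiv.apply_symm_apply, Prod.fst_sub, ← h1, sub_eq_zero]
  constructor
  · rintro rfl
    rfl
  · intro h
    exact hp.codChart.injOn (hp.source_subset_preimage_source he₁) hx h

/-- A fibre product along a submersion has slice charts. -/
theorem exists_sliceChart (hd : d = 2 * m) {p : E → X} {s t : G → X}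
    (hp : IsSubmersionOfComplement F (𝓡 k) (𝓡 m) ∞ p)
    (hs : ContMDiff (𝓡 d) (𝓡 m) ∞ s) (ht : ContMDiff (𝓡 d) (𝓡 m) ∞ t)
    (a : {a : E × G × E // p a.1 = t a.2.1 ∧ p a.2.2 = s a.2.1}) :
    ∃ Θ : SliceChart (EuclideanSpace ℝ (Fin (2 * k)))
      (EuclideanSpace ℝ (Fin m) × EuclideanSpace ℝ (Fin m)) ((𝓡 k).prod ((𝓡 d).prod (𝓡 k)))
      (fun a : E × G × E => p a.1 = t a.2.1 ∧ p a.2.2 = s a.2.1), a.1 ∈ Θ.chart.source := by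
  obtain ⟨⟨e', g, e⟩, h', h⟩ := a
  replace h' : p e' = t g := h'
  replace h : p e = s g := h
  let P' := hp e'
  let P := hp e
  let χ := chartAt (EuclideanSpace ℝ (Fin d)) g
  have hχ : χ ∈ IsManifold.maximalAtlas (𝓡 d) ∞ G := IsManifold.chart_mem_maximalAtlas g
  have hcont : ∀ {f : G → X}, ContMDiff (𝓡 d) (𝓡 m) ∞ f → ∀ (U : Set X), IsOpen U →
      IsOpen (χ.target ∩ (f ∘ χ.symm) ⁻¹' U) := fun {f} hf U hU =>
    (hf.continuous.comp_continuousOn χ.continuousOn_symm).isOpen_inter_preimage χ.open_target hU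
  -- The coordinates `χ g` for which `t g` and `s g` both lie in the codomain charts of `p`, so that
  -- both lifts used in the shear are defined.
  let W := (χ.target ∩ (t ∘ χ.symm) ⁻¹' P'.codChart.source) ∩
    (χ.target ∩ (s ∘ χ.symm) ⁻¹' P.codChart.source)
  have hW : IsOpen W := (hcont ht _ P'.codChart.open_source).inter
    (hcont hs _ P.codChart.open_source)
  have hsm : ∀ {f : G → X} (_ : ContMDiff (𝓡 d) (𝓡 m) ∞ f) {ψ : OpenPartialHomeomorph X _}
      (_ : ψ ∈ IsManifold.maximalAtlas (𝓡 m) ∞ X)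
      (L : EuclideanSpace ℝ (Fin k) ≃L[ℝ] EuclideanSpace ℝ (Fin m) × F),
      ContDiffOn ℝ ∞ (fun y => L.symm (ψ (f (χ.symm y)), 0))
        (χ.target ∩ (f ∘ χ.symm) ⁻¹' ψ.source) := by
    intro f hf ψ hψ L
    have h1 : ContMDiffOn (𝓡 d) (𝓡 m) ∞ (ψ ∘ f ∘ χ.symm)
        (χ.target ∩ (f ∘ χ.symm) ⁻¹' ψ.source) :=
      (contMDiffOn_of_mem_maximalAtlas hψ).comp
        ((hf.comp_contMDiffOn (contMDiffOn_symm_of_mem_maximalAtlas hχ)).mono fun y hy => hy.1)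
        fun y hy => hy.2
    rw [contMDiffOn_iff_contDiffOn] at h1
    have h2 : ContDiff ℝ ∞ (fun z : EuclideanSpace ℝ (Fin m) => L.symm (z, (0 : F))) := by fun_prop
    exact h2.comp_contDiffOn h1
  have hα := (hsm ht P'.codChart_mem_maximalAtlas P'.equiv).mono
    (Set.inter_subset_left : W ⊆ _)
  have hβ := (hsm hs P.codChart_mem_maximalAtlas P.equiv).mono
    (Set.inter_subset_right : W ⊆ _)
  -- The dimension count is `2k + 2m = k + d + k`, which is where `d = 2m` enters.
  obtain ⟨Λ, hΛ⟩ := exists_splitting (R := EuclideanSpace ℝ (Fin (2 * k)))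
    (D := EuclideanSpace ℝ (Fin d)) P'.equiv P.equiv (by simp; omega)
  refine ⟨⟨(P'.domChart.prod (χ.prod P.domChart)).trans
    (shear W hW _ _ hα.continuousOn hβ.continuousOn), ?_, Λ, ?_⟩, ?_⟩
  · exact trans_mem_maximalAtlas (IsManifold.mem_maximalAtlas_prod P'.domChart_mem_maximalAtlas
      (IsManifold.mem_maximalAtlas_prod hχ P.domChart_mem_maximalAtlas))
      (shear_mem_groupoid hW hα hβ)
  · rintro ⟨e₁, g₁, e₂⟩ hq
    rw [OpenPartialHomeomorph.trans_source] at hq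
    obtain ⟨⟨he₁, hg₁, he₂⟩, hy⟩ := hq
    replace hg₁ : g₁ ∈ χ.source := hg₁
    replace he₁ : e₁ ∈ P'.domChart.source := he₁
    replace he₂ : e₂ ∈ P.domChart.source := he₂
    replace hy : χ g₁ ∈ W := hy
    have ht₁ : t g₁ ∈ P'.codChart.source := by
      have : t (χ.symm (χ g₁)) ∈ P'.codChart.source := hy.1.2
      rwa [χ.left_inv hg₁] at this
    have hs₁ : s g₁ ∈ P.codChart.source := by
      have : s (χ.symm (χ g₁)) ∈ P.codChart.source := hy.2.2
      rwa [χ.left_inv hg₁] at this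
    rw [hΛ, Prod.mk_eq_zero]
    refine and_congr ?_ ?_
    · refine (eq_iff_of_submersion P' he₁ ht₁).trans ?_
      change _ ↔ (P'.equiv (P'.domChart e₁ -
        P'.equiv.symm (P'.codChart (t (χ.symm (χ g₁))), 0))).1 = 0
      rw [χ.left_inv hg₁]
    · refine (eq_iff_of_submersion P he₂ hs₁).trans ?_
      change _ ↔ (P.equiv (P.domChart e₂ -
        P.equiv.symm (P.codChart (s (χ.symm (χ g₁))), 0))).1 = 0
      rw [χ.left_inv hg₁]
  · rw [OpenPartialHomeomorph.trans_source]
    have hg : g ∈ χ.source := mem_chart_source _ g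
    refine ⟨⟨P'.mem_domChart_source, hg, P.mem_domChart_source⟩, ?_⟩
    change χ g ∈ W
    refine ⟨⟨χ.map_source hg, ?_⟩, χ.map_source hg, ?_⟩
    · change t (χ.symm (χ g)) ∈ P'.codChart.source
      rw [χ.left_inv hg, ← h']
      exact P'.mem_codChart_source
    · change s (χ.symm (χ g)) ∈ P.codChart.source
      rw [χ.left_inv hg, ← h]
      exact P.mem_codChart_source

end Arrows

/-! ### From full dual pairs to linear dual pairs on tangent spaces -/

section DualPairs

open Manifold

variable {d m : ℕ}
  {S : Type*} [TopologicalSpace S] [ChartedSpace (EuclideanSpace ℝ (Fin d)) S]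
  {M : Type*} [TopologicalSpace M] [ChartedSpace (EuclideanSpace ℝ (Fin m)) M]
  [IsManifold (𝓡 m) ∞ M]

/-- A full dual pair is one at the level of tangent spaces. -/
theorem IsFullDualPair.linear {Ω : TwoForm d S} {f₁ f₂ : S → M} {π₁ π₂ : TwoTensorField m M}
    (h : IsFullDualPair Ω f₁ π₁ f₂ (-π₂)) (x : S) :
    LinearDualPair (V := EuclideanSpace ℝ (Fin d)) (X := EuclideanSpace ℝ (Fin m))
      (Y := EuclideanSpace ℝ (Fin m)) (Ω x) (mfderiv (𝓡 d) (𝓡 m) f₁ x) (π₁ (f₁ x))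
      (mfderiv (𝓡 d) (𝓡 m) f₂ x) (π₂ (f₂ x)) where
  nondegenerate := h.symplectic.nondegenerate x
  surjective_left :=
    mfderiv_surjective_of_submersion (h.submersion_left.isSubmersionOfComplement_complement x)
  surjective_right :=
    mfderiv_surjective_of_submersion (h.submersion_right.isSubmersionOfComplement_complement x)
  poisson_left := h.poisson_left.2 x
  poisson_right := h.poisson_right.2 x
  orthogonal := h.orthogonal x

end DualPairs

/-! ### The pullback groupoid, for a given embedded manifold structure on its arrows -/

section PullbackGroupoid

open Manifold

variable {m k d l : ℕ}
  {X : Type*} [TopologicalSpace X] [ChartedSpace (EuclideanSpace ℝ (Fin m)) X]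
  [IsManifold (𝓡 m) ∞ X]
  {E : Type*} [TopologicalSpace E] [ChartedSpace (EuclideanSpace ℝ (Fin k)) E]
  [IsManifold (𝓡 k) ∞ E]
  {G : Type*} [TopologicalSpace G] [ChartedSpace (EuclideanSpace ℝ (Fin d)) G]
  [IsManifold (𝓡 d) ∞ G]
  {𝒢 : Gpd X G} {p : E → X}
  [ChartedSpace (EuclideanSpace ℝ (Fin l)) (𝒢.PullbackArrows p)]

variable (k d l 𝒢 p) in
/-- The given manifold structure on the arrows of the pullback groupoid is the one of an embedded
submanifold. -/
abbrev ArrowsEmbedded : Prop :=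
  IsSmoothEmbedding (𝓡 l) ((𝓡 k).prod ((𝓡 d).prod (𝓡 k))) ∞
    (Subtype.val : 𝒢.PullbackArrows p → E × G × E)

namespace ArrowsEmbedded

theorem src (hι : ArrowsEmbedded k d l 𝒢 p) : ContMDiff (𝓡 l) (𝓡 k) ∞ (𝒢.pullback p).src :=
  contMDiff_snd.comp (contMDiff_snd.comp hι.contMDiff)

theorem tgt (hι : ArrowsEmbedded k d l 𝒢 p) : ContMDiff (𝓡 l) (𝓡 k) ∞ (𝒢.pullback p).tgt :=
  contMDiff_fst.comp hι.contMDiff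

theorem proj (hι : ArrowsEmbedded k d l 𝒢 p) : ContMDiff (𝓡 l) (𝓡 d) ∞ (𝒢.pullbackProj p) :=
  contMDiff_fst.comp (contMDiff_snd.comp hι.contMDiff)

/-- Smoothness of maps into the space of arrows. -/
theorem contMDiff_iff {H' E' N : Type*} [NormedAddCommGroup E'] [NormedSpace ℝ E']
    [TopologicalSpace H'] {I : ModelWithCorners ℝ E' H'} [TopologicalSpace N] [ChartedSpace H' N]
    (hι : ArrowsEmbedded k d l 𝒢 p) {f : N → 𝒢.PullbackArrows p}
    (hf : ContMDiff I ((𝓡 k).prod ((𝓡 d).prod (𝓡 k))) ∞ (Subtype.val ∘ f)) :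
    ContMDiff I (𝓡 l) ∞ f :=
  (ContMDiff.iff_comp_isImmersion hι.isImmersion).2
    ⟨hι.isEmbedding.continuous_iff.2 hf.continuous, hf⟩

/-- The version relative to a subset serves the multiplication, which is smooth only within the
composable pairs. -/
theorem contMDiffWithinAt_of_val {H' E' N : Type*} [NormedAddCommGroup E'] [NormedSpace ℝ E']
    [TopologicalSpace H'] {I : ModelWithCorners ℝ E' H'} [TopologicalSpace N] [ChartedSpace H' N]
    (hι : ArrowsEmbedded k d l 𝒢 p) {f : N → 𝒢.PullbackArrows p} {s : Set N} {z : N} (hz : z ∈ s)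
    (hf : ContMDiffWithinAt I ((𝓡 k).prod ((𝓡 d).prod (𝓡 k))) ∞ (Subtype.val ∘ f) s z) :
    ContMDiffWithinAt I (𝓡 l) ∞ f s z :=
  contMDiffWithinAt_of_comp_immersion
    (hι.isImmersion.isImmersionOfComplement_complement (f z)) hz
    (hι.isEmbedding.continuousWithinAt_iff.2 hf.continuousWithinAt) hf

/-- Curves of arrows are made from curves in the factors. -/
theorem exists_arrow_curve (hι : ArrowsEmbedded k d l 𝒢 p) (a : 𝒢.PullbackArrows p)
    {γ' γ : ℝ → E} {c : ℝ → G} (hγ' : ContMDiffAt 𝓘(ℝ, ℝ) (𝓡 k) ∞ γ' 0)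
    (hc : ContMDiffAt 𝓘(ℝ, ℝ) (𝓡 d) ∞ c 0) (hγ : ContMDiffAt 𝓘(ℝ, ℝ) (𝓡 k) ∞ γ 0)
    (hγ'0 : γ' 0 = a.1.1) (hc0 : c 0 = a.1.2.1) (hγ0 : γ 0 = a.1.2.2)
    (h' : p ∘ γ' =ᶠ[𝓝 0] 𝒢.tgt ∘ c) (h : p ∘ γ =ᶠ[𝓝 0] 𝒢.src ∘ c) :
    ∃ Γ : ℝ → 𝒢.PullbackArrows p, Γ 0 = a ∧ ContMDiffAt 𝓘(ℝ, ℝ) (𝓡 l) ∞ Γ 0 ∧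
      (𝒢.pullback p).tgt ∘ Γ =ᶠ[𝓝 0] γ' ∧ 𝒢.pullbackProj p ∘ Γ =ᶠ[𝓝 0] c ∧
      (𝒢.pullback p).src ∘ Γ =ᶠ[𝓝 0] γ := by
  classical
  -- The two equations hold only near time `0`; elsewhere the curve takes the irrelevant value `a`.
  let Γ : ℝ → 𝒢.PullbackArrows p := fun τ =>
    if hτ : p (γ' τ) = 𝒢.tgt (c τ) ∧ p (γ τ) = 𝒢.src (c τ) then ⟨(γ' τ, c τ, γ τ), hτ⟩ else a
  have hΓ : ∀ᶠ τ in 𝓝 0, (Γ τ).1 = (γ' τ, c τ, γ τ) := by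
    filter_upwards [h', h] with τ h1 h2
    have hτ : p (γ' τ) = 𝒢.tgt (c τ) ∧ p (γ τ) = 𝒢.src (c τ) := ⟨h1, h2⟩
    simp only [Γ, dif_pos hτ]
  refine ⟨Γ, ?_, ?_, ?_, ?_, ?_⟩
  · refine Subtype.ext (hΓ.self_of_nhds.trans ?_)
    rw [hγ'0, hc0, hγ0]
  · rw [← contMDiffWithinAt_univ]
    refine hι.contMDiffWithinAt_of_val (Set.mem_univ _) ?_
    rw [contMDiffWithinAt_univ]
    exact (hγ'.prodMk (hc.prodMk hγ)).congr_of_eventuallyEq hΓ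
  · filter_upwards [hΓ] with τ hτ
    exact congrArg (fun q : E × G × E => q.1) hτ
  · filter_upwards [hΓ] with τ hτ
    exact congrArg (fun q : E × G × E => q.2.1) hτ
  · filter_upwards [hΓ] with τ hτ
    exact congrArg (fun q : E × G × E => q.2.2) hτ

variable [IsManifold (𝓡 l) ∞ (𝒢.PullbackArrows p)]

/-- The identity `p ∘ s = s ∘ 𝐩` is differentiated along a curve. Velocities live in the model
space, so the base points `p e` and `s g`, equal only propositionally, cause no mismatch of types.
-/
theorem mfderiv_src_comp (hι : ArrowsEmbedded k d l 𝒢 p) (hp : ContMDiff (𝓡 k) (𝓡 m) ∞ p)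
    (hs : ContMDiff (𝓡 d) (𝓡 m) ∞ 𝒢.src) (a : 𝒢.PullbackArrows p) (w : EuclideanSpace ℝ (Fin l)) :
    (mfderiv (𝓡 k) (𝓡 m) p a.1.2.2 (mfderiv (𝓡 l) (𝓡 k) (𝒢.pullback p).src a w :
      EuclideanSpace ℝ (Fin k)) : EuclideanSpace ℝ (Fin m)) =
    (mfderiv (𝓡 d) (𝓡 m) 𝒢.src a.1.2.1 (mfderiv (𝓡 l) (𝓡 d) (𝒢.pullbackProj p) a w :
      EuclideanSpace ℝ (Fin d)) : EuclideanSpace ℝ (Fin m)) := by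
  obtain ⟨Γ, hΓ0, hΓ, rfl⟩ := exists_curve (I := 𝓡 l) a w
  have hd := hΓ.mdifferentiableAt (by simp)
  rw [← velocity_comp hΓ0 (hι.src a |>.mdifferentiableAt (by simp)) hd,
    ← velocity_comp hΓ0 (hι.proj a |>.mdifferentiableAt (by simp)) hd,
    ← velocity_comp (x := a.1.2.2) (congrArg (𝒢.pullback p).src hΓ0)
      (hp _ |>.mdifferentiableAt (by simp))
      ((hι.src.contMDiffAt.comp 0 hΓ).mdifferentiableAt (by simp)),
    ← velocity_comp (x := a.1.2.1) (congrArg (𝒢.pullbackProj p) hΓ0)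
      (hs _ |>.mdifferentiableAt (by simp))
      ((hι.proj.contMDiffAt.comp 0 hΓ).mdifferentiableAt (by simp))]
  congr 1
  funext τ
  exact (Γ τ).2.2

theorem mfderiv_tgt_comp (hι : ArrowsEmbedded k d l 𝒢 p) (hp : ContMDiff (𝓡 k) (𝓡 m) ∞ p)
    (ht : ContMDiff (𝓡 d) (𝓡 m) ∞ 𝒢.tgt) (a : 𝒢.PullbackArrows p) (w : EuclideanSpace ℝ (Fin l)) :
    (mfderiv (𝓡 k) (𝓡 m) p a.1.1 (mfderiv (𝓡 l) (𝓡 k) (𝒢.pullback p).tgt a w :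
      EuclideanSpace ℝ (Fin k)) : EuclideanSpace ℝ (Fin m)) =
    (mfderiv (𝓡 d) (𝓡 m) 𝒢.tgt a.1.2.1 (mfderiv (𝓡 l) (𝓡 d) (𝒢.pullbackProj p) a w :
      EuclideanSpace ℝ (Fin d)) : EuclideanSpace ℝ (Fin m)) := by
  obtain ⟨Γ, hΓ0, hΓ, rfl⟩ := exists_curve (I := 𝓡 l) a w
  have hd := hΓ.mdifferentiableAt (by simp)
  rw [← velocity_comp hΓ0 (hι.tgt a |>.mdifferentiableAt (by simp)) hd,
    ← velocity_comp hΓ0 (hι.proj a |>.mdifferentiableAt (by simp)) hd,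
    ← velocity_comp (x := a.1.1) (congrArg (𝒢.pullback p).tgt hΓ0)
      (hp _ |>.mdifferentiableAt (by simp))
      ((hι.tgt.contMDiffAt.comp 0 hΓ).mdifferentiableAt (by simp)),
    ← velocity_comp (x := a.1.2.1) (congrArg (𝒢.pullbackProj p) hΓ0)
      (ht _ |>.mdifferentiableAt (by simp))
      ((hι.proj.contMDiffAt.comp 0 hΓ).mdifferentiableAt (by simp))]
  congr 1
  funext τ
  exact (Γ τ).2.1

/-- The tangent space of the fibre product is all of the fibre product of tangent spaces: `u` is
realised by a curve in `G`, whose images under `t` and `s` are lifted along `p` with velocities `v'`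
and `v`. -/
theorem exists_tangent (hι : ArrowsEmbedded k d l 𝒢 p) (hp : IsSubmersion (𝓡 k) (𝓡 m) ∞ p)
    (hs : ContMDiff (𝓡 d) (𝓡 m) ∞ 𝒢.src) (ht : ContMDiff (𝓡 d) (𝓡 m) ∞ 𝒢.tgt)
    (a : 𝒢.PullbackArrows p) (v' v : EuclideanSpace ℝ (Fin k)) (u : EuclideanSpace ℝ (Fin d))
    (hv : (mfderiv (𝓡 k) (𝓡 m) p a.1.2.2 v : EuclideanSpace ℝ (Fin m)) =
      mfderiv (𝓡 d) (𝓡 m) 𝒢.src a.1.2.1 u)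
    (hv' : (mfderiv (𝓡 k) (𝓡 m) p a.1.1 v' : EuclideanSpace ℝ (Fin m)) =
      mfderiv (𝓡 d) (𝓡 m) 𝒢.tgt a.1.2.1 u) :
    ∃ w : EuclideanSpace ℝ (Fin l),
      (mfderiv (𝓡 l) (𝓡 k) (𝒢.pullback p).tgt a w : EuclideanSpace ℝ (Fin k)) = v' ∧
      (mfderiv (𝓡 l) (𝓡 d) (𝒢.pullbackProj p) a w : EuclideanSpace ℝ (Fin d)) = u ∧
      (mfderiv (𝓡 l) (𝓡 k) (𝒢.pullback p).src a w : EuclideanSpace ℝ (Fin k)) = v := by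
  obtain ⟨c, hc0, hc, rfl⟩ := exists_curve (I := 𝓡 d) a.1.2.1 u
  have hlift : ∀ {f : G → X} (_ : ContMDiff (𝓡 d) (𝓡 m) ∞ f) {e : E} (_ : p e = f a.1.2.1)
      {v : EuclideanSpace ℝ (Fin k)} (_ : (mfderiv (𝓡 k) (𝓡 m) p e v : EuclideanSpace ℝ (Fin m)) =
        mfderiv (𝓡 d) (𝓡 m) f a.1.2.1 (velocity (𝓡 d) c : EuclideanSpace ℝ (Fin d))),
      ∃ γ : ℝ → E, γ 0 = e ∧ ContMDiffAt 𝓘(ℝ, ℝ) (𝓡 k) ∞ γ 0 ∧ velocity (𝓡 k) γ = v ∧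
        p ∘ γ =ᶠ[𝓝 0] f ∘ c := by
    intro f hf e he v hv
    refine exists_lift_curve (hp.isSubmersionOfComplement_complement e)
      ((congrArg f hc0).trans he.symm) (hf.contMDiffAt.comp 0 hc) (hv.trans ?_)
    exact (velocity_comp hc0 (hf.contMDiffAt.mdifferentiableAt (by simp))
      (hc.mdifferentiableAt (by simp))).symm
  obtain ⟨γ', hγ'0, hγ', hγ'v, hpγ'⟩ := hlift ht a.2.1 hv'
  obtain ⟨γ, hγ0, hγ, hγv, hpγ⟩ := hlift hs a.2.2 hv
  obtain ⟨Γ, hΓ0, hΓ, h1, h2, h3⟩ := hι.exists_arrow_curve a hγ' hc hγ hγ'0 hc0 hγ0 hpγ' hpγ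
  have hd := hΓ.mdifferentiableAt (by simp)
  refine ⟨velocity (𝓡 l) Γ, ?_, ?_, ?_⟩
  · rw [← hγ'v, ← velocity_congr h1]
    exact (velocity_comp hΓ0 (hι.tgt a |>.mdifferentiableAt (by simp)) hd).symm
  · rw [← velocity_congr h2]
    exact (velocity_comp hΓ0 (hι.proj a |>.mdifferentiableAt (by simp)) hd).symm
  · rw [← hγv, ← velocity_congr h3]
    exact (velocity_comp hΓ0 (hι.src a |>.mdifferentiableAt (by simp)) hd).symm

/-- The three tangent maps are the components of the differential of the inclusion, which is an
immersion. -/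
theorem tangent_injective (hι : ArrowsEmbedded k d l 𝒢 p) (a : 𝒢.PullbackArrows p)
    {w w' : EuclideanSpace ℝ (Fin l)}
    (hT : (mfderiv (𝓡 l) (𝓡 k) (𝒢.pullback p).tgt a w : EuclideanSpace ℝ (Fin k)) =
      mfderiv (𝓡 l) (𝓡 k) (𝒢.pullback p).tgt a w')
    (hP : (mfderiv (𝓡 l) (𝓡 d) (𝒢.pullbackProj p) a w : EuclideanSpace ℝ (Fin d)) =
      mfderiv (𝓡 l) (𝓡 d) (𝒢.pullbackProj p) a w')
    (hS : (mfderiv (𝓡 l) (𝓡 k) (𝒢.pullback p).src a w : EuclideanSpace ℝ (Fin k)) =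
      mfderiv (𝓡 l) (𝓡 k) (𝒢.pullback p).src a w') : w = w' := by
  refine mfderiv_injective_of_immersion
    (hι.isImmersion.isImmersionOfComplement_complement a) ?_
  have h : ∀ w : EuclideanSpace ℝ (Fin l), (mfderiv (𝓡 l) ((𝓡 k).prod ((𝓡 d).prod (𝓡 k)))
      (Subtype.val : 𝒢.PullbackArrows p → E × G × E) a w : EuclideanSpace ℝ (Fin k) ×
        EuclideanSpace ℝ (Fin d) × EuclideanSpace ℝ (Fin k)) =
      (mfderiv (𝓡 l) (𝓡 k) (𝒢.pullback p).tgt a w, mfderiv (𝓡 l) (𝓡 d) (𝒢.pullbackProj p) a w,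
        mfderiv (𝓡 l) (𝓡 k) (𝒢.pullback p).src a w) := by
    intro w
    have hT := hι.tgt a |>.mdifferentiableAt (n := ∞) (by simp)
    have hP := hι.proj a |>.mdifferentiableAt (n := ∞) (by simp)
    have hS := hι.src a |>.mdifferentiableAt (n := ∞) (by simp)
    exact congrArg (fun L : EuclideanSpace ℝ (Fin l) →L[ℝ] EuclideanSpace ℝ (Fin k) ×
        EuclideanSpace ℝ (Fin d) × EuclideanSpace ℝ (Fin k) => L w)
      ((hT.hasMFDerivAt.prodMk (hP.hasMFDerivAt.prodMk hS.hasMFDerivAt)).mfderiv)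
  exact (h w).trans ((Prod.ext hT (Prod.ext hP hS)).trans (h w').symm)

theorem composable_proj {q : 𝒢.PullbackArrows p × 𝒢.PullbackArrows p}
    (hq : q ∈ (𝒢.pullback p).composable) :
    (𝒢.pullbackProj p q.1, 𝒢.pullbackProj p q.2) ∈ 𝒢.composable :=
  q.1.2.2.symm.trans ((congrArg p hq).trans q.2.2.1)

theorem mulMap_val {q : 𝒢.PullbackArrows p × 𝒢.PullbackArrows p}
    (hq : q ∈ (𝒢.pullback p).composable) :
    ((𝒢.pullback p).mulMap q).1 =
      (q.1.1.1, 𝒢.mulMap (𝒢.pullbackProj p q.1, 𝒢.pullbackProj p q.2), q.2.1.2.2) := by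
  have h1 : (𝒢.pullback p).mulMap q = (𝒢.pullback p).mul q.1 q.2 hq := dif_pos hq
  have h2 : 𝒢.mulMap (𝒢.pullbackProj p q.1, 𝒢.pullbackProj p q.2) =
    𝒢.mul _ _ (composable_proj hq) := dif_pos (composable_proj hq)
  rw [h1, h2]
  rfl

theorem tgt_mulMap {q : 𝒢.PullbackArrows p × 𝒢.PullbackArrows p}
    (hq : q ∈ (𝒢.pullback p).composable) :
    (𝒢.pullback p).tgt ((𝒢.pullback p).mulMap q) = (𝒢.pullback p).tgt q.1 := by
  have h := congrArg (fun q : E × G × E => q.1) (mulMap_val hq)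
  exact h

theorem src_mulMap {q : 𝒢.PullbackArrows p × 𝒢.PullbackArrows p}
    (hq : q ∈ (𝒢.pullback p).composable) :
    (𝒢.pullback p).src ((𝒢.pullback p).mulMap q) = (𝒢.pullback p).src q.2 := by
  have h := congrArg (fun q : E × G × E => q.2.2) (mulMap_val hq)
  exact h

theorem proj_mulMap {q : 𝒢.PullbackArrows p × 𝒢.PullbackArrows p}
    (hq : q ∈ (𝒢.pullback p).composable) :
    𝒢.pullbackProj p ((𝒢.pullback p).mulMap q) =
      𝒢.mulMap (𝒢.pullbackProj p q.1, 𝒢.pullbackProj p q.2) := by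
  have h := congrArg (fun q : E × G × E => q.2.1) (mulMap_val hq)
  exact h

theorem isLie (hι : ArrowsEmbedded k d l 𝒢 p) (hp : ContMDiff (𝓡 k) (𝓡 m) ∞ p)
    (h𝒢 : 𝒢.IsLie m d) (hsrc : IsSubmersion (𝓡 l) (𝓡 k) ∞ (𝒢.pullback p).src)
    (htgt : IsSubmersion (𝓡 l) (𝓡 k) ∞ (𝒢.pullback p).tgt) : (𝒢.pullback p).IsLie k l where
  src_submersion := hsrc
  tgt_submersion := htgt
  one_smooth := hι.contMDiff_iff (contMDiff_id.prodMk ((h𝒢.one_smooth.comp hp).prodMk contMDiff_id))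
  inv_smooth := hι.contMDiff_iff (hι.src.prodMk ((h𝒢.inv_smooth.comp hι.proj).prodMk hι.tgt))
  mul_smooth := by
    intro q hq
    refine hι.contMDiffWithinAt_of_val hq ?_
    have h1 : ContMDiff ((𝓡 l).prod (𝓡 l)) ((𝓡 d).prod (𝓡 d)) ∞
        (fun q : 𝒢.PullbackArrows p × 𝒢.PullbackArrows p =>
          (𝒢.pullbackProj p q.1, 𝒢.pullbackProj p q.2)) :=
      (hι.proj.comp contMDiff_fst).prodMk (hι.proj.comp contMDiff_snd)
    have h2 := h𝒢.mul_smooth.comp h1.contMDiffOn fun q (hq : q ∈ (𝒢.pullback p).composable) =>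
      composable_proj hq
    refine ((((hι.tgt.comp contMDiff_fst).contMDiffOn).prodMk
      (h2.prodMk (hι.src.comp contMDiff_snd).contMDiffOn)) q hq).congr (fun q hq => ?_) ?_
    · exact mulMap_val hq
    · exact mulMap_val hq

/-- The tangent map of the multiplication of a pullback groupoid. -/
theorem mul_tangent {F : Type*} [NormedAddCommGroup F] [NormedSpace ℝ F]
    (hι : ArrowsEmbedded k d l 𝒢 p) {q : 𝒢.PullbackArrows p × 𝒢.PullbackArrows p}
    (hsrc : IsSubmersionAtOfComplement F (𝓡 l) (𝓡 k) ∞ (𝒢.pullback p).src q.1)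
    (hq : q ∈ (𝒢.pullback p).composable)
    {D : EuclideanSpace ℝ (Fin l) × EuclideanSpace ℝ (Fin l) →L[ℝ] EuclideanSpace ℝ (Fin l)}
    (hD : HasMFDerivWithinAt ((𝓡 l).prod (𝓡 l)) (𝓡 l) (𝒢.pullback p).mulMap
      (𝒢.pullback p).composable q D)
    {D' : EuclideanSpace ℝ (Fin d) × EuclideanSpace ℝ (Fin d) →L[ℝ] EuclideanSpace ℝ (Fin d)}
    (hD' : HasMFDerivWithinAt ((𝓡 d).prod (𝓡 d)) (𝓡 d) 𝒢.mulMap 𝒢.composable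
      (𝒢.pullbackProj p q.1, 𝒢.pullbackProj p q.2) D')
    {v w : EuclideanSpace ℝ (Fin l)}
    (hvw : (mfderiv (𝓡 l) (𝓡 k) (𝒢.pullback p).src q.1 v : EuclideanSpace ℝ (Fin k)) =
      mfderiv (𝓡 l) (𝓡 k) (𝒢.pullback p).tgt q.2 w) :
    (mfderiv (𝓡 l) (𝓡 k) (𝒢.pullback p).tgt ((𝒢.pullback p).mulMap q) (D (v, w)) :
        EuclideanSpace ℝ (Fin k)) = mfderiv (𝓡 l) (𝓡 k) (𝒢.pullback p).tgt q.1 v ∧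
    (mfderiv (𝓡 l) (𝓡 k) (𝒢.pullback p).src ((𝒢.pullback p).mulMap q) (D (v, w)) :
        EuclideanSpace ℝ (Fin k)) = mfderiv (𝓡 l) (𝓡 k) (𝒢.pullback p).src q.2 w ∧
    (mfderiv (𝓡 l) (𝓡 d) (𝒢.pullbackProj p) ((𝒢.pullback p).mulMap q) (D (v, w)) :
        EuclideanSpace ℝ (Fin d)) =
      D' (mfderiv (𝓡 l) (𝓡 d) (𝒢.pullbackProj p) q.1 v,
        mfderiv (𝓡 l) (𝓡 d) (𝒢.pullbackProj p) q.2 w) := by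
  obtain ⟨b, hb0, hb, rfl⟩ := exists_curve (I := 𝓡 l) q.2 w
  have hbd := hb.mdifferentiableAt (n := ∞) (by simp)
  have hT : ∀ x, MDifferentiableAt (𝓡 l) (𝓡 k) (𝒢.pullback p).tgt x :=
    fun x => (hι.tgt x).mdifferentiableAt (by simp)
  have hS : ∀ x, MDifferentiableAt (𝓡 l) (𝓡 k) (𝒢.pullback p).src x :=
    fun x => (hι.src x).mdifferentiableAt (by simp)
  have hP : ∀ x, MDifferentiableAt (𝓡 l) (𝓡 d) (𝒢.pullbackProj p) x :=
    fun x => (hι.proj x).mdifferentiableAt (by simp)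
  -- Lifting `t ∘ b` along the source realises `(v, w)` by a curve of composable pairs, on which `D`
  -- is determined.
  obtain ⟨a, ha0, ha, rfl, hab⟩ := exists_lift_curve hsrc
    (c := (𝒢.pullback p).tgt ∘ b) ((congrArg (𝒢.pullback p).tgt hb0).trans hq.symm)
    (hι.tgt.contMDiffAt.comp 0 hb) (hvw.trans (velocity_comp hb0 (hT _) hbd).symm)
  have had := ha.mdifferentiableAt (n := ∞) (by simp)
  have hγ : MDifferentiableAt 𝓘(ℝ, ℝ) ((𝓡 l).prod (𝓡 l)) (fun τ => (a τ, b τ)) 0 :=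
    had.prodMk hbd
  have hγ0 : (fun τ => (a τ, b τ)) 0 = q := Prod.ext ha0 hb0
  have hγc : ∀ᶠ τ in 𝓝 (0 : ℝ), (a τ, b τ) ∈ (𝒢.pullback p).composable := hab
  have hDv : velocity (𝓡 l) ((𝒢.pullback p).mulMap ∘ fun τ => (a τ, b τ)) =
      D (velocity (𝓡 l) a, velocity (𝓡 l) b) := by
    rw [velocity_comp_within hγ0 hD hγ hγc, velocity_prodMk had hbd]
  have hmd : MDifferentiableAt 𝓘(ℝ, ℝ) (𝓡 l)
      ((𝒢.pullback p).mulMap ∘ fun τ => (a τ, b τ)) 0 :=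
    mdifferentiableAt_comp_within hγ0 hD hγ hγc
  have hm0 : ((𝒢.pullback p).mulMap ∘ fun τ => (a τ, b τ)) 0 = (𝒢.pullback p).mulMap q :=
    congrArg (𝒢.pullback p).mulMap hγ0
  rw [← hDv]
  refine ⟨?_, ?_, ?_⟩
  · refine (velocity_comp hm0 (hT _) hmd).symm.trans
      ((velocity_congr ?_).trans (velocity_comp ha0 (hT _) had))
    filter_upwards [hγc] with τ hτ
    exact tgt_mulMap hτ
  · refine (velocity_comp hm0 (hS _) hmd).symm.trans
      ((velocity_congr ?_).trans (velocity_comp hb0 (hS _) hbd))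
    filter_upwards [hγc] with τ hτ
    exact src_mulMap hτ
  · have hPa : MDifferentiableAt 𝓘(ℝ, ℝ) (𝓡 d) (𝒢.pullbackProj p ∘ a) 0 :=
      (hP _).comp 0 had
    have hPb : MDifferentiableAt 𝓘(ℝ, ℝ) (𝓡 d) (𝒢.pullbackProj p ∘ b) 0 :=
      (hP _).comp 0 hbd
    rw [← velocity_comp ha0 (hP _) had, ← velocity_comp hb0 (hP _) hbd,
      ← velocity_prodMk hPa hPb]
    refine (velocity_comp hm0 (hP _) hmd).symm.trans ((velocity_congr ?_).trans
      (velocity_comp_within (Prod.ext (congrArg (𝒢.pullbackProj p) ha0)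
        (congrArg (𝒢.pullbackProj p) hb0)) hD' (hPa.prodMk hPb) ?_))
    · filter_upwards [hγc] with τ hτ
      exact proj_mulMap hτ
    · filter_upwards [hγc] with τ hτ
      exact composable_proj hτ

theorem pullbackForm_apply (ΩX : TwoForm d G) (σ : TwoForm k E) (a : 𝒢.PullbackArrows p)
    (v w : EuclideanSpace ℝ (Fin l)) :
    𝒢.pullbackForm (l := l) p ΩX σ a ![v, w] =
      ΩX.toModel (𝒢.pullbackProj p a) ![mfderiv (𝓡 l) (𝓡 d) (𝒢.pullbackProj p) a v,
        mfderiv (𝓡 l) (𝓡 d) (𝒢.pullbackProj p) a w] +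
      σ.toModel ((𝒢.pullback p).src a) ![mfderiv (𝓡 l) (𝓡 k) (𝒢.pullback p).src a v,
        mfderiv (𝓡 l) (𝓡 k) (𝒢.pullback p).src a w] -
      σ.toModel ((𝒢.pullback p).tgt a) ![mfderiv (𝓡 l) (𝓡 k) (𝒢.pullback p).tgt a v,
        mfderiv (𝓡 l) (𝓡 k) (𝒢.pullback p).tgt a w] := by
  have h : ∀ {n : ℕ} (L : EuclideanSpace ℝ (Fin l) →L[ℝ] EuclideanSpace ℝ (Fin n))
      (Ω : EuclideanSpace ℝ (Fin n) [⋀^Fin 2]→L[ℝ] ℝ),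
      Ω.compContinuousLinearMap L ![v, w] = Ω ![L v, L w] := by
    intro n L Ω
    rw [ContinuousAlternatingMap.compContinuousLinearMap_apply]
    congr 1
    ext i
    fin_cases i <;> rfl
  exact congrArg₂ (fun x y : ℝ => x - y) (congrArg₂ (fun x y : ℝ => x + y) (h _ _) (h _ _)) (h _ _)

/-- Base points and tangent vectors are replaced simultaneously, since rewriting a base point alone
would disturb the types of the vectors. -/
theorem pullbackForm_eq (ΩX : TwoForm d G) (σ : TwoForm k E) {a : 𝒢.PullbackArrows p} {g : G}
    {e e' : E} (hg : 𝒢.pullbackProj p a = g) (he : (𝒢.pullback p).src a = e)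
    (he' : (𝒢.pullback p).tgt a = e') {u v : EuclideanSpace ℝ (Fin l)}
    {Pu Pv : EuclideanSpace ℝ (Fin d)} {Su Sv Tu Tv : EuclideanSpace ℝ (Fin k)}
    (hPu : (mfderiv (𝓡 l) (𝓡 d) (𝒢.pullbackProj p) a u : EuclideanSpace ℝ (Fin d)) = Pu)
    (hPv : (mfderiv (𝓡 l) (𝓡 d) (𝒢.pullbackProj p) a v : EuclideanSpace ℝ (Fin d)) = Pv)
    (hSu : (mfderiv (𝓡 l) (𝓡 k) (𝒢.pullback p).src a u : EuclideanSpace ℝ (Fin k)) = Su)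
    (hSv : (mfderiv (𝓡 l) (𝓡 k) (𝒢.pullback p).src a v : EuclideanSpace ℝ (Fin k)) = Sv)
    (hTu : (mfderiv (𝓡 l) (𝓡 k) (𝒢.pullback p).tgt a u : EuclideanSpace ℝ (Fin k)) = Tu)
    (hTv : (mfderiv (𝓡 l) (𝓡 k) (𝒢.pullback p).tgt a v : EuclideanSpace ℝ (Fin k)) = Tv) :
    𝒢.pullbackForm (l := l) p ΩX σ a ![u, v] =
      ΩX.toModel g ![Pu, Pv] + σ.toModel e ![Su, Sv] - σ.toModel e' ![Tu, Tv] := by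
  subst hg he he' hPu hPv hSu hSv hTu hTv
  exact pullbackForm_apply ΩX σ a u v

/-- The projection to `G` respects products, so the `ΩX` terms add up by multiplicativity. Of the
`σ` terms, those at the middle point, the source of the first arrow and target of the second,
cancel. -/
theorem isMultiplicative (hι : ArrowsEmbedded k d l 𝒢 p) (hp : ContMDiff (𝓡 k) (𝓡 m) ∞ p)
    (h𝒢 : 𝒢.IsLie m d) (hsrc : IsSubmersion (𝓡 l) (𝓡 k) ∞ (𝒢.pullback p).src)
    {ΩX : TwoForm d G} (hΩ : 𝒢.IsMultiplicative m ΩX) (σ : TwoForm k E)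
    (hs : ContMDiff (𝓡 d) (𝓡 m) ∞ 𝒢.src) (ht : ContMDiff (𝓡 d) (𝓡 m) ∞ 𝒢.tgt) :
    (𝒢.pullback p).IsMultiplicative k (𝒢.pullbackForm (l := l) p ΩX σ) := by
  intro q hq D hD v v' w w' hvw hvw'
  have hq' := composable_proj hq
  obtain ⟨D', hD'⟩ : ∃ D' : EuclideanSpace ℝ (Fin d) × EuclideanSpace ℝ (Fin d) →L[ℝ]
      EuclideanSpace ℝ (Fin d), HasMFDerivWithinAt ((𝓡 d).prod (𝓡 d)) (𝓡 d) 𝒢.mulMap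
      𝒢.composable (𝒢.pullbackProj p q.1, 𝒢.pullbackProj p q.2) D' :=
    ⟨_, ((h𝒢.mul_smooth _ hq').mdifferentiableWithinAt (by simp)).hasMFDerivWithinAt⟩
  have hsub := hsrc.isSubmersionOfComplement_complement q.1
  obtain ⟨hT, hS, hP⟩ := hι.mul_tangent hsub hq hD hD' hvw
  obtain ⟨hT', hS', hP'⟩ := hι.mul_tangent hsub hq hD hD' hvw'
  have hcomp : ∀ {v w : EuclideanSpace ℝ (Fin l)},
      ((mfderiv (𝓡 l) (𝓡 k) (𝒢.pullback p).src q.1 v : EuclideanSpace ℝ (Fin k)) =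
        mfderiv (𝓡 l) (𝓡 k) (𝒢.pullback p).tgt q.2 w) →
      (mfderiv (𝓡 d) (𝓡 m) 𝒢.src q.1.1.2.1 (mfderiv (𝓡 l) (𝓡 d) (𝒢.pullbackProj p) q.1 v :
        EuclideanSpace ℝ (Fin d)) : EuclideanSpace ℝ (Fin m)) =
      mfderiv (𝓡 d) (𝓡 m) 𝒢.tgt q.2.1.2.1 (mfderiv (𝓡 l) (𝓡 d) (𝒢.pullbackProj p) q.2 w :
        EuclideanSpace ℝ (Fin d)) := by
    intro v w h
    rw [← hι.mfderiv_src_comp hp hs, ← hι.mfderiv_tgt_comp hp ht, h]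
    have hq₀ : q.1.1.2.2 = q.2.1.1 := hq
    exact congrArg (fun e : E => ((mfderiv (𝓡 k) (𝓡 m) p e :
      EuclideanSpace ℝ (Fin k) →L[ℝ] EuclideanSpace ℝ (Fin m)) _)) hq₀
  have hmul := hΩ _ hq' D' hD' _ _ _ _ (hcomp hvw) (hcomp hvw')
  -- In the first factor the source term is rewritten as the target term of the second factor, so
  -- that it can cancel; it is the `t` in `hring`.
  refine (pullbackForm_eq ΩX σ (proj_mulMap hq) (src_mulMap hq) (tgt_mulMap hq)
    hP hP' hS hS' hT hT').trans (Eq.trans ?_ (congrArg₂ (fun x y : ℝ => x + y)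
      (pullbackForm_eq ΩX σ rfl hq rfl rfl rfl hvw hvw' rfl rfl)
      (pullbackForm_apply ΩX σ q.2 w w')).symm)
  have hring : ∀ {x x₁ x₂ y z t : ℝ}, x = x₁ + x₂ → x + y - z = (x₁ + t - z) + (x₂ + y - t) := by
    intro x x₁ x₂ y z t h
    rw [h]
    ring
  exact hring hmul

end ArrowsEmbedded

end PullbackGroupoid

/-! ### The dual pair of the pullback groupoid -/

section PullbackIntegrates

open Manifold

variable {m k d : ℕ}
  {X : Type*} [TopologicalSpace X] [ChartedSpace (EuclideanSpace ℝ (Fin m)) X]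
  [IsManifold (𝓡 m) ∞ X]
  {E : Type*} [TopologicalSpace E] [ChartedSpace (EuclideanSpace ℝ (Fin k)) E]
  [IsManifold (𝓡 k) ∞ E]
  {G : Type*} [TopologicalSpace G] [ChartedSpace (EuclideanSpace ℝ (Fin d)) G]
  [IsManifold (𝓡 d) ∞ G]
  {𝒢 : Gpd X G} {p : E → X}

namespace ArrowsEmbedded

/-- The tangent spaces of the pullback groupoid carry linear dual pairs. -/
theorem linearDualPair {l : ℕ} [ChartedSpace (EuclideanSpace ℝ (Fin l)) (𝒢.PullbackArrows p)]
    [IsManifold (𝓡 l) ∞ (𝒢.PullbackArrows p)] (hι : ArrowsEmbedded k d l 𝒢 p)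
    {πX : TwoTensorField m X} {ΩX : TwoForm d G} (h𝒢 : 𝒢.Integrates ΩX πX)
    (hp : IsSubmersion (𝓡 k) (𝓡 m) ∞ p) {σ : TwoForm k E} {πE : TwoTensorField k E}
    (hgauge : ∀ e : E, bivectorGraph (πE e) = gaugeTransform (σ e)
      (backwardImage (mfderiv (𝓡 k) (𝓡 m) p e) (bivectorGraph (πX (p e)))))
    (a : 𝒢.PullbackArrows p) :
    LinearDualPair (V := EuclideanSpace ℝ (Fin l)) (X := EuclideanSpace ℝ (Fin k))
      (Y := EuclideanSpace ℝ (Fin k)) (𝒢.pullbackForm (l := l) p ΩX σ a)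
      (mfderiv (𝓡 l) (𝓡 k) (𝒢.pullback p).src a) (πE ((𝒢.pullback p).src a))
      (mfderiv (𝓡 l) (𝓡 k) (𝒢.pullback p).tgt a) (πE ((𝒢.pullback p).tgt a)) := by
  -- The base point is freed so that `πX` can be taken at `s g` and `t g` instead of `p e`.
  have hg : ∀ (e : E) (x : X), p e = x →
      bivectorGraph (V := EuclideanSpace ℝ (Fin k)) (πE e) =
        gaugeTransform (V := EuclideanSpace ℝ (Fin k)) (σ e)
          (backwardImage (V := EuclideanSpace ℝ (Fin k)) (W := EuclideanSpace ℝ (Fin m))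
            (mfderiv (𝓡 k) (𝓡 m) p e) (bivectorGraph (V := EuclideanSpace ℝ (Fin m)) (πX x))) := by
    rintro e _ rfl
    exact hgauge e
  have hps : ∀ e, Function.Surjective (mfderiv (𝓡 k) (𝓡 m) p e) := fun e =>
    mfderiv_surjective_of_submersion (hp.isSubmersionOfComplement_complement e)
  have hpc : ContMDiff (𝓡 k) (𝓡 m) ∞ p := fun e =>
    (hp.isSubmersionOfComplement_complement e).contMDiffAt
  have hs := h𝒢.dualPair.poisson_left.1
  have ht := h𝒢.dualPair.poisson_right.1
  let P : EuclideanSpace ℝ (Fin l) →L[ℝ] EuclideanSpace ℝ (Fin d) :=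
    mfderiv (𝓡 l) (𝓡 d) (𝒢.pullbackProj p) a
  exact (h𝒢.dualPair.linear (𝒢.pullbackProj p a)).pullback (hps _) (hps _)
    (hg _ _ a.2.2) (hg _ _ a.2.1) (P := P)
    (hι.mfderiv_src_comp hpc hs a) (hι.mfderiv_tgt_comp hpc ht a)
    (fun v' u v h h' => hι.exists_tangent hp hs ht a v' v u h h')
    (fun w h1 h2 h3 => hι.tangent_injective a (h1.trans (map_zero _).symm)
      (h2.trans (map_zero _).symm) (h3.trans (map_zero _).symm))
    (fun u v => pullbackForm_apply ΩX σ a u v)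

variable [ChartedSpace (EuclideanSpace ℝ (Fin (2 * k))) (𝒢.PullbackArrows p)]
  [IsManifold (𝓡 (2 * k)) ∞ (𝒢.PullbackArrows p)]

/-- The fibres have dimension `2k - k = k`, which fixes the model of the complement. -/
theorem isSubmersion_of_surjective {f : 𝒢.PullbackArrows p → E}
    (hf : ContMDiff (𝓡 (2 * k)) (𝓡 k) ∞ f)
    (hs : ∀ a, Function.Surjective (mfderiv (𝓡 (2 * k)) (𝓡 k) f a)) :
    IsSubmersion (𝓡 (2 * k)) (𝓡 k) ∞ f :=
  IsSubmersionOfComplement.isSubmersion (F := EuclideanSpace ℝ (Fin k)) fun a =>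
    isSubmersionAt_of_mfderiv_surjective hf (hs a) (by simp; omega)

/-- The pullback groupoid integrates the gauge transform of the pulled back Poisson structure. -/
theorem integrates (hι : ArrowsEmbedded k d (2 * k) 𝒢 p)
    {πX : TwoTensorField m X} {ΩX : TwoForm d G} (h𝒢 : 𝒢.Integrates ΩX πX)
    (hp : IsSubmersion (𝓡 k) (𝓡 m) ∞ p) {σ : TwoForm k E} (hσs : σ.IsSmooth) (hσc : σ.IsClosed)
    {πE : TwoTensorField k E}
    (hgauge : ∀ e : E, bivectorGraph (πE e) = gaugeTransform (σ e)
      (backwardImage (mfderiv (𝓡 k) (𝓡 m) p e) (bivectorGraph (πX (p e))))) :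
    (𝒢.pullback p).Integrates (𝒢.pullbackForm (l := 2 * k) p ΩX σ) πE := by
  have hlin := hι.linearDualPair h𝒢 hp hgauge
  have hpc : ContMDiff (𝓡 k) (𝓡 m) ∞ p := fun e =>
    (hp.isSubmersionOfComplement_complement e).contMDiffAt
  have hsrc := isSubmersion_of_surjective hι.src fun a => (hlin a).surjective_left
  have htgt := isSubmersion_of_surjective hι.tgt fun a => (hlin a).surjective_right
  obtain ⟨⟨hlie, hΩ, hmul⟩, hdual⟩ := h𝒢
  have hP := hΩ.smooth.pullback hι.proj
  have hS := hσs.pullback hι.src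
  have hT := hσs.pullback hι.tgt
  have hPc := hΩ.closed.pullback hι.proj hΩ.smooth
  have hSc := hσc.pullback hι.src hσs
  have hTc := hσc.pullback hι.tgt hσs
  have hsymp : (𝒢.pullbackForm (l := 2 * k) p ΩX σ).IsSymplectic :=
    ⟨(hP.add hS).sub hT, TwoForm.IsClosed.sub (hP.add hS) hT
      (TwoForm.IsClosed.add hP hS hPc hSc) hTc, fun a => (hlin a).nondegenerate⟩
  refine ⟨⟨hι.isLie hpc hlie hsrc htgt, hsymp, hι.isMultiplicative hpc hlie hsrc hmul σ
    hdual.poisson_left.1 hdual.poisson_right.1⟩, hsymp, hsrc, htgt, ?_, ?_,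
    ⟨hι.src, fun a => (hlin a).poisson_left⟩, ⟨hι.tgt, fun a => (hlin a).poisson_right⟩,
    fun a => (hlin a).orthogonal⟩
  · exact fun e => ⟨(𝒢.pullback p).one e, rfl⟩
  · exact fun e => ⟨(𝒢.pullback p).one e, rfl⟩

end ArrowsEmbedded

end PullbackIntegrates

end SymplGpd

theorem mainTheorem4 {m k d : ℕ}
    {X : Type*} [TopologicalSpace X] [ChartedSpace (EuclideanSpace ℝ (Fin m)) X]
    [IsManifold (𝓡 m) ∞ X] [T2Space X] [SecondCountableTopology X]
    {E : Type*} [TopologicalSpace E] [ChartedSpace (EuclideanSpace ℝ (Fin k)) E]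
    [IsManifold (𝓡 k) ∞ E] [T2Space E] [SecondCountableTopology E]
    {G : Type*} [TopologicalSpace G] [ChartedSpace (EuclideanSpace ℝ (Fin d)) G]
    [IsManifold (𝓡 d) ∞ G]
    (πX : SymplGpd.TwoTensorField m X) (hπX : πX.IsPoisson)
    (𝒢 : SymplGpd.Gpd X G) (ΩX : SymplGpd.TwoForm d G) (h𝒢 : 𝒢.Integrates ΩX πX)
    (p : E → X) (hp : Manifold.IsSubmersion (𝓡 k) (𝓡 m) ∞ p) (hps : Function.Surjective p)
    (σ : SymplGpd.TwoForm k E) (hσs : σ.IsSmooth) (hσc : σ.IsClosed)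
    (πE : SymplGpd.TwoTensorField k E) (hπE : πE.IsPoisson)
    (hgauge : ∀ e : E, SymplGpd.bivectorGraph (πE e) =
      SymplGpd.gaugeTransform (σ e)
        (SymplGpd.backwardImage (mfderiv (𝓡 k) (𝓡 m) p e) (SymplGpd.bivectorGraph (πX (p e))))) :
    ∃ (_ : ChartedSpace (EuclideanSpace ℝ (Fin (2 * k))) (𝒢.PullbackArrows p))
      (_ : IsManifold (𝓡 (2 * k)) ∞ (𝒢.PullbackArrows p)),
      Manifold.IsSmoothEmbedding (𝓡 (2 * k)) ((𝓡 k).prod ((𝓡 d).prod (𝓡 k))) ∞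
        (Subtype.val : 𝒢.PullbackArrows p → E × G × E) ∧
      (𝒢.pullback p).Integrates (𝒢.pullbackForm (l := 2 * k) p ΩX σ) πE := by

  -- The dimension of `G` is constrained only if there is an arrow; slice charts are needed only
  -- around arrows, so this suffices.
  have hdim : ∀ g : G, d = 2 * m := fun g => by
    simpa using (h𝒢.dualPair.linear g).finrank_eq rfl
  have hΘ := fun a : 𝒢.PullbackArrows p => SymplGpd.exists_sliceChart (hdim a.1.2.1)
    hp.isSubmersionOfComplement_complement h𝒢.dualPair.poisson_left.1
    h𝒢.dualPair.poisson_right.1 a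
  choose Θ hΘ using hΘ
  let _ := SymplGpd.SliceChart.chartedSpace Θ hΘ
  have _ := SymplGpd.SliceChart.isManifold Θ hΘ
  have hι : SymplGpd.ArrowsEmbedded k d (2 * k) 𝒢 p :=
    SymplGpd.SliceChart.isSmoothEmbedding Θ hΘ
  exact ⟨_, SymplGpd.SliceChart.isManifold Θ hΘ, hι, hι.integrates h𝒢 hp hσs hσc hgauge⟩
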